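/- Let $n,p\ge 1$, let $X\in\mathbb{Q}^{n\times p}$ have rows $x_1^{T},\dots,x_n^{T}$, let $y\in\mathbb{Q}^n$, and assume that $(X,y)$ has no two identical rows. For $\beta\in\mathbb{R}^p$ put $r_i^\beta=y_i-x_i^{T}\beta$. For a permutation $\pi$ of $\{1,\dots,n\}$ let $C^\pi=\{\beta: r^\beta_{\pi(1)}\le\dots\le r^\beta_{\pi(n)}\}$, and let $\mathcal{C}$ be the set of those $\pi$ for which $C^\pi$ is full-dimensional (the cells of the arrangement $\mathcal{A}(\mathcal{H})$ of the hyperplanes $H_{ij}=\{\beta: r_i^\beta=r_j^\beta\}$, $i<j$). Let $\mathcal{R}$ be the set of the pairs $\{k,\ell\}$, $k<\ell$, for which there are $i<j$ with $H_{ij}=H_{k\ell}$ and $(i,j)$ lexicographically smaller than $(k,\ell)$. *Numbering of the rows.* Assume that the rows are numbered so that no row $(x_m,y_m)$ lies strictly between (on the open segment joining) two rows $(x_i,y_i)$, $(x_j,y_j)$ with $x_i\ne x_j$ and $i,j<m$. Every matrix $(X,y)$ has such a numbering of its rows (this is part of the claim), and if no three rows are collinear, every numbering is of this kind. *Algorithm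 RSIncEnu.* The input is $(X,y)$ and a rational point $\beta$ in the interior of some $C^\pi$. Construct $\mathcal{R}$ (by normalizing the equations of the $H_{ij}$ and sorting them) and call RSIncEnu$(\beta,\emptyset)$. A call RSIncEnu$(\beta, L)$ sorts the residuals, $r^\beta_{\pi(1)}<\dots<r^\beta_{\pi(n)}$, and outputs $C^\pi$. Then, for $i=1,\dots,n-1$, if $\{\pi(i),\pi(i+1)\}=\{k,\ell\}\notin\mathcal{R}\cup L$ with $k<\ell$, it solves the linear program of maximizing $\varepsilon$ over $(\beta,\varepsilon)$ subject to $r^\beta_{\pi(m)}+\varepsilon\le r^\beta_{\pi(m+1)}$ for all $m\le n-1$ with $\{\pi(m),\pi(m+1)\}\notin\mathcal{R}\cup\{\{k,\ell\}\}$, $r_k^\beta=r_\ell^\beta$, and $\varepsilon\le 1$. If there is a maximizer $(\beta^*,\varepsilon^*)$ with $\varepsilon^*>0$, it computes $\beta^0=\frac12(\beta^*+\beta'')$, where $\beta''$ is the first point beyond $\beta^*$ in which the ray from $\beta$ through $\beta^*$ meets another hyperplane ($\beta^0=2\beta^*-\beta$ if there is none), replaces its list $L$ by $L\cup\{\{k,\ell\}\}$,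 calls RSIncEnu$(\beta^0,L)$ (the list is passed by value), and goes on with the loop. *Cost model.* Arithmetic operations, comparisons, and reading or writing a memory word (a rational number or an index) take one step each. Space is the largest number of words in use at one time; the output is a stream and is not stored. Linear programs are solved by an arbitrary correct subroutine, which takes at least one step for each coefficient of the constraints of its input. Let $\mathrm{lp}(n,p)$ denote any upper bound on its time (respectively on its space) for linear programs with $O(n)$ constraints, $O(p)$ variables and bit size $O(\mathrm{bitsize}(X,y))$. **Theorem.** (a) RSIncEnu constructs $\mathcal{R}$ correctly and outputs all elements of $\mathcal{C}$, and nothing else; every element is output exactly once. (b) The total time of RSIncEnu is $O(n\cdot|\mathcal{C}|\cdot\mathrm{lp}(n,p)+n^2\log n\cdot p)$, and its space is $O(\mathrm{lp}(n,p)+n^2p)$. All the constants in the $O(\cdot)$ are absolute: they do not depend on $n$, $p$, $X$, $y$, the starting point or the linear programming subroutine. -/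

import Mathlib

/-! # Geometry: residuals, hyperplanes, cells -/

namespace RankCells

/-- The residual `r_i = y_i - x_iᵀ β`, over `ℚ` (in computations) or over `ℝ` (in the geometry). -/
def residual {K : Type} [Field K] {n p : ℕ} (X : Fin n → Fin p → ℚ) (y : Fin n → ℚ)
    (β : Fin p → K) (i : Fin n) : K :=
  (y i : K) - ∑ k, (X i k : K) * β k

/-- The polyhedron `C^π` of all `β ∈ ℝ^p` with `r_{π(1)} ≤ r_{π(2)} ≤ ⋯ ≤ r_{π(n)}`. -/
def region {n p : ℕ} (X : Fin n → Fin p → ℚ) (y : Fin n → ℚ) (π : Equiv.Perm (Fin n)) :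
    Set (Fin p → ℝ) :=
  {β | ∀ i j : Fin n, i ≤ j → residual X y β (π i) ≤ residual X y β (π j)}

/-- `𝒞`: the permutations `π` for which the convex polyhedron `C^π` is full-dimensional. -/
def cells {n p : ℕ} (X : Fin n → Fin p → ℚ) (y : Fin n → ℚ) : Set (Equiv.Perm (Fin n)) :=
  {π | (interior (region X y π)).Nonempty}

/-- The set `H_{ij}` of all `β ∈ ℝ^p` with `r_i = r_j`. -/
def hyperplane {n p : ℕ} (X : Fin n → Fin p → ℚ) (y : Fin n → ℚ) (i j : Fin n) :
    Set (Fin p → ℝ) :=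
  {β | residual X y β i = residual X y β j}

/-- The redundant pairs `{k, l}`, stored as `(k, l)` with `k < l`: those for which some
lexicographically smaller pair `(i, j)`, `i < j`, has `H_{ij} = H_{kl}`. -/
def redundantPairs {n p : ℕ} (X : Fin n → Fin p → ℚ) (y : Fin n → ℚ) : Set (Fin n × Fin n) :=
  {e | e.1 < e.2 ∧ ∃ i j : Fin n, i < j ∧ hyperplane X y i j = hyperplane X y e.1 e.2 ∧
    toLex (i, j) < toLex e}

/-- `(X, y)` contains no pair of identical rows. -/
def DistinctRows {n p : ℕ} (X : Fin n → Fin p → ℚ) (y : Fin n → ℚ) : Prop :=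
  ∀ i j : Fin n, X i = X j → y i = y j → i = j

/-- The numbering of the rows is admissible: no row `(x_m, y_m)` lies strictly between two rows
`(x_i, y_i)`, `(x_j, y_j)` with `x_i ≠ x_j` that both precede it. -/
def AdmissibleNumbering {n p : ℕ} (X : Fin n → Fin p → ℚ) (y : Fin n → ℚ) : Prop :=
  ∀ i j m : Fin n, i < j → j < m → X i ≠ X j →
    (X m, y m) ∉ openSegment ℚ (X i, y i) (X j, y j)

/-! # Bit sizes -/

/-- Bits of the numerator and the denominator in lowest terms, plus one for the sign. -/
def bitsize (q : ℚ) : ℕ := q.num.natAbs.size + q.den.size + 1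

/-- The bit size of the data `(X, y)`. -/
def dataBitsize {n p : ℕ} (X : Fin n → Fin p → ℚ) (y : Fin n → ℚ) : ℕ :=
  ∑ i, (∑ k, bitsize (X i k) + bitsize (y i))

/-! # Computations with a step count and a peak memory count

The cost model is the usual unit-cost one: a memory word holds a rational number or an index, and
an arithmetic operation, a comparison, or reading or writing a word takes one step.
`Cost α` is the outcome of a computation: its result, the number of steps, and the largest number
of words of working memory in use at one time. -/

structure Cost (α : Type) where
  val : α
  time : ℕ
  space : ℕ

namespace Cost

/-- Sequential composition: the times add up, and memory is reused. -/
instance : Monad Cost where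
  pure a := ⟨a, 0, 0⟩
  bind m f := ⟨(f m.val).val, m.time + (f m.val).time, max m.space (f m.val).space⟩

/-- `c` elementary steps with result `a`. -/
def steps {α : Type} (c : ℕ) (a : α) : Cost α := ⟨a, c, 0⟩

/-- One elementary step. -/
def tick {α : Type} (a : α) : Cost α := steps 1 a

/-- Run `m` while `w` further words of memory are reserved; they are released at the end. -/
def reserving {α : Type} (w : ℕ) (m : Cost α) : Cost α := ⟨m.val, m.time, m.space + w⟩

/-- Fill an array; each entry takes its own computation and one step to write it. The memory
for the array is reserved by the caller. -/
def tabulate {α : Type} {n : ℕ} (f : Fin n → Cost α) : Cost (Fin n → α) :=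
  ⟨fun i => (f i).val, ∑ i, ((f i).time + 1), Finset.univ.sup fun i => (f i).space⟩

/-- A summation loop; each summand takes its own computation and one addition. -/
def sum {n : ℕ} (f : Fin n → Cost ℚ) : Cost ℚ :=
  ⟨∑ i, (f i).val, ∑ i, ((f i).time + 1), Finset.univ.sup fun i => (f i).space⟩

/-- A loop over a list that updates a state; one step of overhead in each round. -/
def loop {ι σ : Type} (body : σ → ι → Cost σ) : List ι → σ → Cost σ
  | [], s => pure s
  | i :: l, s => do
    let s' ← body s i
    let s'' ← tick s'
    loop body l s''

end Cost

open Cost in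
/-- Merging two sorted lists: one comparison and one step for each element that is moved. -/
def mergeSorted {α : Type} (le : α → α → Cost Bool) : List α → List α → Cost (List α)
  | [], bs => steps bs.length bs
  | a :: as, [] => steps (a :: as).length (a :: as)
  | a :: as, b :: bs => do
    let c ← le a b
    if c then
      let l ← mergeSorted le as (b :: bs)
      tick (a :: l)
    else
      let l ← mergeSorted le (a :: as) bs
      tick (b :: l)
termination_by l₁ l₂ => l₁.length + l₂.length

open Cost in
/-- Merge sort. The elements are indices or pointers, one word each. -/
def mergeSort {α : Type} (le : α → α → Cost Bool) (l : List α) : Cost (List α) :=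
  if h : l.length ≤ 1 then tick l
  else reserving l.length do
    steps l.length ()
    let l₁ ← mergeSort le (l.take (l.length / 2))
    let l₂ ← mergeSort le (l.drop (l.length / 2))
    mergeSorted le l₁ l₂
termination_by l.length
decreasing_by
  all_goals simp only [List.length_take, List.length_drop]; omega

/-! # Linear programs and subroutines that solve them -/

/-- The linear program: maximize `obj · z` over `z ∈ ℚ^q` subject to `a · z ≤ b` for
`(a, b) ∈ ineqs` and `a · z = b` for `(a, b) ∈ eqs`. -/
structure LP (q : ℕ) where
  obj : Fin q → ℚ
  ineqs : List ((Fin q → ℚ) × ℚ)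
  eqs : List ((Fin q → ℚ) × ℚ)

namespace LP

variable {q : ℕ}

def Feasible (I : LP q) (z : Fin q → ℚ) : Prop :=
  (∀ c ∈ I.ineqs, ∑ k, c.1 k * z k ≤ c.2) ∧ (∀ c ∈ I.eqs, ∑ k, c.1 k * z k = c.2)

def value (I : LP q) (z : Fin q → ℚ) : ℚ := ∑ k, I.obj k * z k

def IsMaximizer (I : LP q) (z : Fin q → ℚ) : Prop :=
  I.Feasible z ∧ ∀ w, I.Feasible w → I.value w ≤ I.value z

/-- The number of constraints. -/
def constraints (I : LP q) : ℕ := I.ineqs.length + I.eqs.length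

/-- The total bit size of the objective and of all constraints. -/
def bitsize (I : LP q) : ℕ :=
  ∑ k, RankCells.bitsize (I.obj k) +
    ((I.ineqs ++ I.eqs).map fun c => ∑ k, RankCells.bitsize (c.1 k) + RankCells.bitsize c.2).sum

end LP

/-- The three possible answers to a linear program. -/
inductive LPAnswer (q : ℕ) where
  | infeasible : LPAnswer q
  | unbounded : LPAnswer q
  | optimal (z : Fin q → ℚ) : LPAnswer q

/-- What it means that an answer to a linear program is right. -/
def LPAnswer.IsRight {q : ℕ} (I : LP q) : LPAnswer q → Prop
  | .infeasible => ∀ z, ¬ I.Feasible z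
  | .unbounded => ∀ t : ℚ, ∃ z, I.Feasible z ∧ t < I.value z
  | .optimal z => I.IsMaximizer z

/-- A correct subroutine for linear programming, with its running time and its memory on each
instance. Any such subroutine may be plugged into the enumeration algorithm. -/
structure LPSolver where
  solve : ∀ {q : ℕ}, LP q → LPAnswer q
  time : ∀ {q : ℕ}, LP q → ℕ
  space : ∀ {q : ℕ}, LP q → ℕ
  right : ∀ {q : ℕ} (I : LP q), (solve I).IsRight I
  /-- The solver reads its input, one coefficient in a step. -/
  reads : ∀ {q : ℕ} (I : LP q), I.constraints * (q + 1) ≤ time I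

/-- `f m v B` bounds the cost of every linear program with at most `m` constraints, at most `v`
variables and bit size at most `B`. -/
def BoundsLPCost (cost : ∀ {q : ℕ}, LP q → ℕ) (f : ℕ → ℕ → ℕ → ℕ) : Prop :=
  ∀ (m v B q : ℕ) (I : LP q), I.constraints ≤ m → q ≤ v → I.bitsize ≤ B → cost I ≤ f m v B

def LPSolver.call (S : LPSolver) {q : ℕ} (I : LP q) : Cost (LPAnswer q) :=
  ⟨S.solve I, S.time I, S.space I⟩

/-! # The enumeration algorithm -/

section Algorithm

open Cost

variable {n p : ℕ}

/-- All pairs `(i, j)`. -/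
def allPairs (n : ℕ) : List (Fin n × Fin n) := List.finRange n ×ˢ List.finRange n

/-- Lexicographic comparison of two vectors. -/
def compareVectors {d : ℕ} (u v : Fin d → ℚ) : Cost Ordering :=
  loop (fun o k => tick (o.then (compare (u k) (v k)))) (List.finRange d) Ordering.eq

/-- The normal form of the equation of `H_{ij}`: the coefficients of `x_i - x_j` and the right-hand
side `y_i - y_j`, divided by the first one that is not zero. -/
def normalForm (X : Fin n → Fin p → ℚ) (y : Fin n → ℚ) (i j : Fin n) :
    Cost (Fin (p + 1) → ℚ) := do
  let v ← tabulate fun k : Fin (p + 1) =>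
    tick ((Fin.snoc (X i) (y i) : Fin (p + 1) → ℚ) k - (Fin.snoc (X j) (y j) : Fin (p + 1) → ℚ) k)
  let c ← loop (fun s k => tick (if s = 0 then v k else s)) (List.finRange (p + 1)) (0 : ℚ)
  tabulate fun k => tick (v k / c)

/-- The pairs in a sorted list whose normal form agrees with that of their predecessor. -/
def markRepeated {d : ℕ} :
    List ((Fin d → ℚ) × (Fin n × Fin n)) → Cost (Finset (Fin n × Fin n))
  | u :: v :: l => do
    let o ← compareVectors u.1 v.1
    let R ← markRepeated (v :: l)
    tick (if o = Ordering.eq then insert v.2 R else R)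
  | _ => pure ∅

/-- Construction of the list `ℛ` of redundant pairs: normalize all the hyperplanes, sort the
normal forms (ties by the lexicographic order of the pairs), and mark repetitions. -/
def constructR (X : Fin n → Fin p → ℚ) (y : Fin n → ℚ) : Cost (Finset (Fin n × Fin n)) :=
  reserving (n * n * (p + 4)) do
    let table ← loop (fun t e =>
        if e.1 < e.2 then do
          let v ← normalForm X y e.1 e.2
          steps 3 ((v, e) :: t)
        else pure t)
      (allPairs n) []
    let sorted ← mergeSort (fun u v => do
        let o ← compareVectors u.1 v.1
        steps 3 ((o.then ((compare u.2.1 v.2.1).then (compare u.2.2 v.2.2))).isLE))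
      table
    markRepeated sorted

/-- The array of the residuals at `β`. -/
def residuals (X : Fin n → Fin p → ℚ) (y : Fin n → ℚ) (β : Fin p → ℚ) : Cost (Fin n → ℚ) :=
  tabulate fun i => do
    let s ← Cost.sum fun k => tick (X i k * β k)
    tick (y i - s)

/-- Sort the residuals at `β`: the array `π` with `r_{π(1)} < ⋯ < r_{π(n)}`. -/
def sortResiduals (X : Fin n → Fin p → ℚ) (y : Fin n → ℚ) (β : Fin p → ℚ) :
    Cost (Fin n → Fin n) :=
  reserving (2 * n) do
    let r ← residuals X y β
    let l ← mergeSort (fun i j => tick (decide (r i ≤ r j))) (List.finRange n)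
    tabulate fun i => tick ((l[(i : ℕ)]?).getD i)

/-- The pair `{i, j}`, written with the smaller index first. -/
def orderedPair (i j : Fin n) : Fin n × Fin n := (min i j, max i j)

/-- The constraint `r_a + t ε ≤ r_b` (or, with `t = 0` and as an equation, `r_a = r_b`) on the
variables `(β, ε)`, in the form `(x_b - x_a)ᵀ β + t ε ≤ y_b - y_a`. -/
def constraintRow (X : Fin n → Fin p → ℚ) (y : Fin n → ℚ) (t : ℚ) (a b : Fin n) :
    Cost ((Fin (p + 1) → ℚ) × ℚ) := do
  let c ← tabulate fun k => tick (X b k - X a k)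
  steps 4 ((Fin.snoc c t : Fin (p + 1) → ℚ), y b - y a)

/-- The linear program for the tightness test of `H_{kl}` at `C^π`: maximize `ε` subject to
`r_{π(m)} + ε ≤ r_{π(m+1)}` for those `m` with `{π(m), π(m+1)} ∉ ℛ ∪ {{k, l}}`, and `r_k = r_l`.
The normalization `ε ≤ 1` does not affect whether the optimal value is positive, and makes sure
that a maximizer exists whenever there is a feasible point. -/
def tightnessLP (X : Fin n → Fin p → ℚ) (y : Fin n → ℚ) (R : Finset (Fin n × Fin n))
    (π : Fin n → Fin n) (k l : Fin n) : Cost (LP (p + 1)) := do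
  let unit ← tabulate fun m : Fin (p + 1) => tick (if m = Fin.last p then (1 : ℚ) else 0)
  let rows ← loop (fun rows (m : Fin n) =>
      if h : (m : ℕ) + 1 < n then
        if orderedPair (π m) (π ⟨m + 1, h⟩) ∉ insert (k, l) R then do
          let row ← constraintRow X y 1 (π m) (π ⟨m + 1, h⟩)
          steps 5 (row :: rows)
        else steps 4 rows
      else pure rows)
    (List.finRange n) []
  let eqn ← constraintRow X y 0 k l
  tick { obj := unit, ineqs := (unit, 1) :: rows, eqs := [eqn] }

/-- Solve the tightness test; if the optimal value `ε*` is positive, return `β*`. -/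
def tightnessTest (S : LPSolver) (X : Fin n → Fin p → ℚ) (y : Fin n → ℚ)
    (R : Finset (Fin n × Fin n)) (π : Fin n → Fin n) (k l : Fin n) :
    Cost (Option (Fin p → ℚ)) :=
  reserving ((n + 2) * (p + 2)) do
    let I ← tightnessLP X y R π k l
    let answer ← S.call I
    match answer with
    | .optimal z => if 0 < z (Fin.last p) then steps (p + 1) (some (Fin.init z)) else tick none
    | _ => tick none

/-- The new interior point. With `β'' = β' + λ (β* - β')` the first point beyond `β*` (that is, with
`λ > 1`) at which the ray from `β'` through `β*` intersects another hyperplane, it is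
`(β* + β'') / 2`. If there is no such point, any point of the ray beyond `β*` will do, and
`β* + (β* - β')` is taken. -/
def nextPoint (X : Fin n → Fin p → ℚ) (y : Fin n → ℚ) (β' βs : Fin p → ℚ) :
    Cost (Fin p → ℚ) :=
  reserving (2 * n + p + 1) do
    let r ← residuals X y β'
    let s ← residuals X y βs
    let param ← loop (fun (best : Option ℚ) (e : Fin n × Fin n) => do
        let a ← tick (r e.1 - r e.2)
        let b ← tick (s e.1 - s e.2)
        -- on the ray, `r_i - r_j = a + λ (b - a)`
        let t ← steps 2 (a / (a - b))
        steps 4 (if e.1 < e.2 ∧ a ≠ b ∧ 1 < t then some (best.elim t (min t)) else best))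
      (allPairs n) none
    match param with
    | some t => tabulate fun k => steps 6 ((βs k + (β' k + t * (βs k - β' k))) / 2)
    | none => tabulate fun k => steps 2 (βs k + (βs k - β' k))

/-- The beginning of a call at the interior point `β`: compute `π`, output `C^π` (in `n` steps),
and go on with `rest π`. The stack frame of the call keeps the point `β` and three more words (the
loop counter, the length of the list `L`, the return address). The result is the stream of all
cells that are output during the call; it is written, not stored. -/
def visit (X : Fin n → Fin p → ℚ) (y : Fin n → ℚ) (β : Fin p → ℚ)
    (rest : (Fin n → Fin n) → Cost (List (Fin n → Fin n))) : Cost (List (Fin n → Fin n)) :=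
  reserving (p + 3) do
    let π ← sortResiduals X y β
    steps n ()
    let later ← rest π
    pure (π :: later)

/-- The rounds `i, i + 1, …` of the for-loop in a call at the interior point `β` with the current
list `L` (the code counts from `0`).

`ℛ` and `L` are kept as `n × n` tables of marks, so that a membership test takes one step, and each
pair in `L` has two more words, which serve to remove it from the table when the call that inserted
it returns. There is a single array for `π`, which is overwritten by the recursive call and is
recomputed afterwards. -/
def rounds (S : LPSolver) (X : Fin n → Fin p → ℚ) (y : Fin n → ℚ) (R : Finset (Fin n × Fin n))
    (β : Fin p → ℚ) (L : Finset (Fin n × Fin n)) (π : Fin n → Fin n) (i : ℕ) :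
    Cost (List (Fin n → Fin n)) :=
  if hi : i + 1 < n then
    let e := orderedPair (π ⟨i, by omega⟩) (π ⟨i + 1, hi⟩)
    if he : e ∉ R ∪ L then do
      -- reading the pair, ordering it, testing membership, and advancing the counter
      steps 10 ()
      let found ← tightnessTest S X y R π e.1 e.2
      match found with
      | some βs => do
          let β₀ ← reserving p (nextPoint X y β βs)
          reserving 2 do
            -- insertion into `L`, and the later removal
            steps 4 ()
            let L' := insert e L
            -- the recursive call at the new point with the enlarged list
            let out₁ ← visit X y β₀ fun π₀ => rounds S X y R β₀ L' π₀ 0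
            let π' ← sortResiduals X y β
            let out₂ ← rounds S X y R β L' π' (i + 1)
            pure (out₁ ++ out₂)
      | none => rounds S X y R β L π (i + 1)
    else do
      steps 10 ()
      rounds S X y R β L π (i + 1)
  else tick []
termination_by ((Finset.univ \ L).card, n - i)
decreasing_by
  · apply Prod.Lex.left
    have hL : e ∉ L := fun h => he (Finset.mem_union_right _ h)
    refine Finset.card_lt_card ⟨?_, fun h => ?_⟩
    · exact Finset.sdiff_subset_sdiff le_rfl (Finset.subset_insert e L)
    · have := h (Finset.mem_sdiff.2 ⟨Finset.mem_univ e, hL⟩)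
      exact (Finset.mem_sdiff.1 this).2 (Finset.mem_insert_self e L)
  · apply Prod.Lex.left
    have hL : e ∉ L := fun h => he (Finset.mem_union_right _ h)
    refine Finset.card_lt_card ⟨?_, fun h => ?_⟩
    · exact Finset.sdiff_subset_sdiff le_rfl (Finset.subset_insert e L)
    · have := h (Finset.mem_sdiff.2 ⟨Finset.mem_univ e, hL⟩)
      exact (Finset.mem_sdiff.1 this).2 (Finset.mem_insert_self e L)
  · apply Prod.Lex.right; omega
  · apply Prod.Lex.right; omega

/-- RSIncEnu on the data `(X, y)`, started at the point `β`: construct `ℛ`, then make the first call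
with the empty list. The memory includes the data, the two tables, the array for `π` and a constant
number of registers. The result is the stream of the output cells, each given by its `π`. -/
def rsIncEnu (S : LPSolver) (X : Fin n → Fin p → ℚ) (y : Fin n → ℚ) (β : Fin p → ℚ) :
    Cost (List (Fin n → Fin n)) :=
  reserving (n * (p + 1) + 2 * (n * n) + n + 20) do
    let R ← constructR X y
    steps (2 * (n * n)) ()
    visit X y β fun π => rounds S X y R β ∅ π 0

end Algorithm

end RankCells

/-!
# Enumeration of the cells of a rank arrangement

Although cells and hyperplanes are subsets of `ℝ^p`, the argument takes place over `ℚ`: the interior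
of a cell is not empty, so it contains rational points, and these are the rational points at which
its permutation sorts the residuals strictly (`sortedAt_iff_mem_interior`,
`exists_mem_cells_iff`). Two pairs have the same hyperplane if and only if the coefficient vectors
of their equations are proportional (`hyperplane_eq_iff`).

A call at a point `β` of a cell with the list `L` outputs the cells that lie on the same side as `β`
of all the hyperplanes in `L` (`rounds_spec`). For a facet of the current cell whose hyperplane `e`
is not in `L`, these cells are divided by `e` into two classes. Those across `e` are output by the
recursive call at a point just beyond the facet, with `e` added to the list, and the others are left
to the remaining rounds, again with `e` in the list. This is why no cell is output twice. After the
last round all facets of the current cell are in `L`, and then no other cell is left, because every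
cell is separated from the current one by a facet of the latter
(`exists_separating_facet`, `eq_of_agreeOn_facets`).

It remains to see that the loop over consecutive pairs that are not in `ℛ` meets each facet. Among
the pairs that define the hyperplane of a facet, the lexicographically smallest one is the one that
is not in `ℛ`. If the residual of a third row `m` were between the two residuals of this pair
`(i, j)`, then all three would agree on the facet, which makes `(x_m, y_m)` a point of the open
segment between the two other rows. An admissible numbering then has `m < j`, and `i` and `m` give a
smaller pair with the same hyperplane (`row_ne_convex_combination`,
`IsFacetPoint.not_between`). For the same reason the linear program contains a constraint for every
facet other than the one that is tested, and recognizes the facets correctly although constraints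
are left out (`PassesTest.isFacetPoint`).

For the time, each round is charged to its call, and each call to the cell that it outputs first.
A solver that reads its input takes at least `n (p + 2)` steps for some linear program of the
admitted size (`le_lpTime`), so that the linear programs dominate the other work; only sorting the
normal forms in `constructR` needs the separate term `n² log n p`. For the space, the pairs in the
list `L` of nested calls are distinct, and thus the depth of the recursion is at most `n²`
(`rounds_space_le`).
-/

namespace RankCells

/-! ### Costs of the elementary constructs -/

namespace Cost

variable {α β ι σ : Type}

@[simp] theorem pure_val (a : α) : (pure a : Cost α).val = a := rfl
@[simp] theorem pure_time (a : α) : (pure a : Cost α).time = 0 := rfl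
@[simp] theorem pure_space (a : α) : (pure a : Cost α).space = 0 := rfl

@[simp] theorem bind_val (m : Cost α) (f : α → Cost β) : (m >>= f).val = (f m.val).val := rfl
@[simp] theorem bind_time (m : Cost α) (f : α → Cost β) :
    (m >>= f).time = m.time + (f m.val).time := rfl
@[simp] theorem bind_space (m : Cost α) (f : α → Cost β) :
    (m >>= f).space = max m.space (f m.val).space := rfl

@[simp] theorem steps_val (c : ℕ) (a : α) : (steps c a).val = a := rfl
@[simp] theorem steps_time (c : ℕ) (a : α) : (steps c a).time = c := rfl
@[simp] theorem steps_space (c : ℕ) (a : α) : (steps c a).space = 0 := rfl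

@[simp] theorem tick_val (a : α) : (tick a).val = a := rfl
@[simp] theorem tick_time (a : α) : (tick a).time = 1 := rfl
@[simp] theorem tick_space (a : α) : (tick a).space = 0 := rfl

@[simp] theorem reserving_val (w : ℕ) (m : Cost α) : (reserving w m).val = m.val := rfl
@[simp] theorem reserving_time (w : ℕ) (m : Cost α) : (reserving w m).time = m.time := rfl
@[simp] theorem reserving_space (w : ℕ) (m : Cost α) :
    (reserving w m).space = m.space + w := rfl

@[simp] theorem tabulate_val {n : ℕ} (f : Fin n → Cost α) (i : Fin n) :
    (tabulate f).val i = (f i).val := rfl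

theorem tabulate_time_le {n : ℕ} {f : Fin n → Cost α} {c : ℕ} (h : ∀ i, (f i).time ≤ c) :
    (tabulate f).time ≤ n * (c + 1) := by
  calc ∑ i, ((f i).time + 1) ≤ ∑ _i : Fin n, (c + 1) :=
        Finset.sum_le_sum fun i _ => Nat.add_le_add_right (h i) 1
    _ = n * (c + 1) := by simp

theorem tabulate_space_le {n : ℕ} {f : Fin n → Cost α} {c : ℕ} (h : ∀ i, (f i).space ≤ c) :
    (tabulate f).space ≤ c := by
  simpa [tabulate] using h

@[simp] theorem sum_val {n : ℕ} (f : Fin n → Cost ℚ) : (Cost.sum f).val = ∑ i, (f i).val := rfl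

theorem sum_time_le {n : ℕ} {f : Fin n → Cost ℚ} {c : ℕ} (h : ∀ i, (f i).time ≤ c) :
    (Cost.sum f).time ≤ n * (c + 1) := by
  calc ∑ i, ((f i).time + 1) ≤ ∑ _i : Fin n, (c + 1) :=
        Finset.sum_le_sum fun i _ => Nat.add_le_add_right (h i) 1
    _ = n * (c + 1) := by simp

theorem sum_space_le {n : ℕ} {f : Fin n → Cost ℚ} {c : ℕ} (h : ∀ i, (f i).space ≤ c) :
    (Cost.sum f).space ≤ c := by
  simpa [Cost.sum] using h

theorem loop_val (body : σ → ι → Cost σ) (l : List ι) (s : σ) :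
    (loop body l s).val = l.foldl (fun s i => (body s i).val) s := by
  induction l generalizing s with
  | nil => rfl
  | cons i l ih => exact ih _

theorem loop_time_le {body : σ → ι → Cost σ} {c : ℕ} (h : ∀ s i, (body s i).time ≤ c)
    (l : List ι) (s : σ) : (loop body l s).time ≤ l.length * (c + 1) := by
  induction l generalizing s with
  | nil => simp [loop]
  | cons i l ih =>
    have h1 := h s i
    have h2 := ih (body s i).val
    simp only [loop, bind_time, tick_time, tick_val, List.length_cons]
    rw [Nat.succ_mul]
    omega

theorem loop_space_le {body : σ → ι → Cost σ} {c : ℕ} (h : ∀ s i, (body s i).space ≤ c)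
    (l : List ι) (s : σ) : (loop body l s).space ≤ c := by
  induction l generalizing s with
  | nil => simp [loop]
  | cons i l ih =>
    have h1 := h s i
    have h2 := ih (body s i).val
    simp only [loop, bind_space, tick_space, tick_val]
    omega

end Cost

open Cost Filter Topology

/-! ### Merge sort -/

section MergeSort

variable {α γ : Type}

theorem mergeSorted_perm (le : α → α → Cost Bool) (l₁ l₂ : List α) :
    (mergeSorted le l₁ l₂).val.Perm (l₁ ++ l₂) := by
  fun_induction mergeSorted le l₁ l₂ with
  | case1 bs => simp
  | case2 a as => simp
  | case3 a as b bs ih₁ ih₂ =>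
    simp only [bind_val]
    split_ifs with h
    · simpa using ih₁
    · simp only [bind_val, tick_val]
      exact (ih₂.cons b).trans (List.perm_middle.symm)

theorem mergeSorted_pairwise [LinearOrder γ] {le : α → α → Cost Bool} {key : α → γ}
    (hle : ∀ a b, (le a b).val = true ↔ key a ≤ key b) (l₁ l₂ : List α)
    (h₁ : l₁.Pairwise fun a b => key a ≤ key b) (h₂ : l₂.Pairwise fun a b => key a ≤ key b) :
    (mergeSorted le l₁ l₂).val.Pairwise fun a b => key a ≤ key b := by
  fun_induction mergeSorted le l₁ l₂ with
  | case1 bs => simpa using h₂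
  | case2 a as => simpa using h₁
  | case3 a as b bs ih₁ ih₂ =>
    simp only [bind_val]
    rw [List.pairwise_cons] at h₁ h₂
    split_ifs with h
    · have hab := (hle a b).1 h
      simp only [bind_val, tick_val, List.pairwise_cons]
      refine ⟨fun x hx => ?_, ih₁ h₁.2 (List.pairwise_cons.2 h₂)⟩
      rcases List.mem_append.1 ((mergeSorted_perm le _ _).subset hx) with hx | hx
      · exact h₁.1 x hx
      · rcases List.mem_cons.1 hx with rfl | hx
        · exact hab
        · exact hab.trans (h₂.1 x hx)
    · have hab : key b ≤ key a := (not_le.1 fun h' => h ((hle a b).2 h')).le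
      simp only [bind_val, tick_val, List.pairwise_cons]
      refine ⟨fun x hx => ?_, ih₂ (List.pairwise_cons.2 h₁) h₂.2⟩
      rcases List.mem_append.1 ((mergeSorted_perm le _ _).subset hx) with hx | hx
      · rcases List.mem_cons.1 hx with rfl | hx
        · exact hab
        · exact hab.trans (h₁.1 x hx)
      · exact h₂.1 x hx

theorem mergeSorted_time_le {le : α → α → Cost Bool} {c : ℕ} (hc : ∀ a b, (le a b).time ≤ c)
    (l₁ l₂ : List α) :
    (mergeSorted le l₁ l₂).time ≤ (c + 1) * (l₁.length + l₂.length) := by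
  fun_induction mergeSorted le l₁ l₂ with
  | case1 bs => simp; nlinarith
  | case2 a as => simp
  | case3 a as b bs ih₁ ih₂ =>
    have h := hc a b
    simp only [bind_time]
    split_ifs
    · simp only [bind_time, tick_time, List.length_cons] at ih₁ ⊢
      linarith
    · simp only [bind_time, tick_time, List.length_cons] at ih₂ ⊢
      linarith

theorem mergeSorted_space_le {le : α → α → Cost Bool} {c : ℕ} (hc : ∀ a b, (le a b).space ≤ c)
    (l₁ l₂ : List α) : (mergeSorted le l₁ l₂).space ≤ c := by
  fun_induction mergeSorted le l₁ l₂ with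
  | case1 bs => simp
  | case2 a as => simp
  | case3 a as b bs ih₁ ih₂ =>
    have h := hc a b
    simp only [bind_space]
    split_ifs <;> simp_all

theorem mergeSort_perm (le : α → α → Cost Bool) (l : List α) :
    (mergeSort le l).val.Perm l := by
  fun_induction mergeSort le l with
  | case1 l h => simp
  | case2 l h ih₁ ih₂ =>
    simp only [reserving_val, bind_val]
    refine (mergeSorted_perm le _ _).trans ((ih₁.append ih₂).trans ?_)
    rw [List.take_append_drop]

theorem mergeSort_pairwise [LinearOrder γ] {le : α → α → Cost Bool} {key : α → γ}
    (hle : ∀ a b, (le a b).val = true ↔ key a ≤ key b) (l : List α) :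
    (mergeSort le l).val.Pairwise fun a b => key a ≤ key b := by
  fun_induction mergeSort le l with
  | case1 l h =>
    match l, h with
    | [], _ => simp
    | [a], _ => simp
  | case2 l h ih₁ ih₂ => exact mergeSorted_pairwise hle _ _ ih₁ ih₂

theorem mergeSort_time_le {le : α → α → Cost Bool} {c : ℕ} (hc : ∀ a b, (le a b).time ≤ c)
    (l : List α) :
    (mergeSort le l).time ≤ (c + 2) * l.length * Nat.clog 2 l.length + max l.length 1 := by
  fun_induction mergeSort le l with
  | case1 l h => exact le_add_left (le_max_right _ _)
  | case2 l h ih₁ ih₂ =>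
    set N := l.length with hN
    have e₁ : (mergeSort le (l.take (N / 2))).val.length = N / 2 := by
      rw [(mergeSort_perm le _).length_eq, List.length_take]; omega
    have e₂ : (mergeSort le (l.drop (N / 2))).val.length = N - N / 2 := by
      rw [(mergeSort_perm le _).length_eq, List.length_drop]
    have hm := mergeSorted_time_le hc (mergeSort le (l.take (N / 2))).val
      (mergeSort le (l.drop (N / 2))).val
    rw [e₁, e₂] at hm
    rw [List.length_take, ← hN, min_eq_left (Nat.div_le_self _ _)] at ih₁
    rw [List.length_drop, ← hN] at ih₂
    have hlog : Nat.clog 2 N = Nat.clog 2 ((N + 1) / 2) + 1 := by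
      rw [Nat.clog_of_two_le one_lt_two (by omega)]
      congr 2
    have hd : N - N / 2 = (N + 1) / 2 := by omega
    have l₁ : Nat.clog 2 (N / 2) ≤ Nat.clog 2 ((N + 1) / 2) := Nat.clog_mono_right 2 (by omega)
    have hs : N / 2 + (N - N / 2) = N := by omega
    rw [max_eq_left (by omega)] at ih₁ ih₂
    rw [max_eq_left (by omega), hlog]
    rw [hs] at hm
    simp only [reserving_time, bind_time, steps_time]
    set q := Nat.clog 2 ((N + 1) / 2)
    have ih₁' : (mergeSort le (l.take (N / 2))).time ≤ (c + 2) * (N / 2) * q + N / 2 :=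
      ih₁.trans (by gcongr)
    have ih₂' : (mergeSort le (l.drop (N / 2))).time ≤ (c + 2) * (N - N / 2) * q + (N - N / 2) :=
      ih₂.trans (by rw [hd])
    have hmul : (c + 2) * (N / 2) * q + (c + 2) * (N - N / 2) * q = (c + 2) * N * q := by
      rw [← add_mul, ← mul_add, hs]
    nlinarith

theorem mergeSort_space_le {le : α → α → Cost Bool} {c : ℕ} (hc : ∀ a b, (le a b).space ≤ c)
    (l : List α) : (mergeSort le l).space ≤ 3 * l.length + c := by
  fun_induction mergeSort le l with
  | case1 l h => simp
  | case2 l h ih₁ ih₂ =>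
    have hm := mergeSorted_space_le hc (mergeSort le (l.take (l.length / 2))).val
      (mergeSort le (l.drop (l.length / 2))).val
    rw [List.length_take] at ih₁
    rw [List.length_drop] at ih₂
    simp only [reserving_space, bind_space, steps_space]
    omega

end MergeSort

/-! ### Affine functions given by their coefficient vectors -/

section Affine

variable {n p : ℕ} {K : Type} [Field K]

/-- The affine function `β ↦ v_p - ∑ k < p, v_k β_k` with coefficient vector `v`. -/
def affVal (v : Fin (p + 1) → ℚ) (β : Fin p → K) : K :=
  (v (Fin.last p) : K) - ∑ k : Fin p, (v k.castSucc : K) * β k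

/-- The row `(x_i, y_i)` as a single vector; it is the coefficient vector of the residual `r_i`. -/
def row (X : Fin n → Fin p → ℚ) (y : Fin n → ℚ) (i : Fin n) : Fin (p + 1) → ℚ :=
  Fin.snoc (X i) (y i)

/-- The coefficient vector of `r_i - r_j`. -/
def diffVec (X : Fin n → Fin p → ℚ) (y : Fin n → ℚ) (i j : Fin n) : Fin (p + 1) → ℚ :=
  row X y i - row X y j

theorem affVal_row (X : Fin n → Fin p → ℚ) (y : Fin n → ℚ) (i : Fin n) (β : Fin p → K) :
    affVal (row X y i) β = residual X y β i := by
  simp [affVal, row, residual]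

theorem affVal_sub [CharZero K] (v w : Fin (p + 1) → ℚ) (β : Fin p → K) :
    affVal (v - w) β = affVal v β - affVal w β := by
  simp only [affVal, Pi.sub_apply, Rat.cast_sub, sub_mul, Finset.sum_sub_distrib]
  ring

theorem affVal_smul [CharZero K] (c : ℚ) (v : Fin (p + 1) → ℚ) (β : Fin p → K) :
    affVal (c • v) β = c * affVal v β := by
  simp only [affVal, Pi.smul_apply, smul_eq_mul, Rat.cast_mul, mul_assoc, ← Finset.mul_sum]
  ring

theorem affVal_diffVec [CharZero K] (X : Fin n → Fin p → ℚ) (y : Fin n → ℚ) (i j : Fin n)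
    (β : Fin p → K) :
    affVal (diffVec X y i j) β = residual X y β i - residual X y β j := by
  rw [diffVec, affVal_sub, affVal_row, affVal_row]

theorem affVal_lineMap (v : Fin (p + 1) → ℚ) (β z : Fin p → K) (t : K) :
    affVal v (β + t • (z - β)) = (1 - t) * affVal v β + t * affVal v z := by
  have h : ∀ k : Fin p, (v k.castSucc : K) * (β + t • (z - β)) k =
      (1 - t) * ((v k.castSucc : K) * β k) + t * ((v k.castSucc : K) * z k) := fun k => by
    simp only [Pi.add_apply, Pi.smul_apply, Pi.sub_apply, smul_eq_mul]; ring
  simp only [affVal, h, Finset.sum_add_distrib, ← Finset.mul_sum]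
  ring

theorem affVal_zero_right (v : Fin (p + 1) → ℚ) :
    affVal v (0 : Fin p → K) = v (Fin.last p) := by
  simp [affVal]

theorem affVal_single (v : Fin (p + 1) → ℚ) (k : Fin p) (t : K) :
    affVal v (Pi.single k t) = v (Fin.last p) - v k.castSucc * t := by
  simp [affVal, Pi.single_apply]

theorem exists_affVal_ne_zero [CharZero K] {v : Fin (p + 1) → ℚ} (hv : v ≠ 0) :
    ∃ d : Fin p → K, affVal v d ≠ 0 := by
  by_contra! h
  have h0 : v (Fin.last p) = 0 := by
    have := h 0
    rw [affVal_zero_right] at this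
    exact_mod_cast this
  apply hv
  ext k
  refine Fin.lastCases h0 (fun k => ?_) k
  have := h (Pi.single k 1)
  rw [affVal_single, h0] at this
  simpa using this

/-- An affine function that vanishes on the zero set of a nonconstant one is a multiple of it. -/
theorem exists_eq_smul_of_zeros_subset {v w : Fin (p + 1) → ℚ} {k₀ : Fin p}
    (hv : v k₀.castSucc ≠ 0) (h : ∀ β : Fin p → ℚ, affVal v β = 0 → affVal w β = 0) :
    ∃ c : ℚ, w = c • v := by
  set t := v (Fin.last p) / v k₀.castSucc with ht
  have hb : affVal v (Pi.single k₀ t : Fin p → ℚ) = 0 := by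
    rw [affVal_single, ht]; simp only [Rat.cast_id]; field_simp; ring
  have hlast := h _ hb
  rw [affVal_single] at hlast
  simp only [Rat.cast_id] at hlast
  refine ⟨w k₀.castSucc / v k₀.castSucc, ?_⟩
  ext k
  refine Fin.lastCases ?_ (fun j => ?_) k
  · simp only [Pi.smul_apply, smul_eq_mul]
    rw [sub_eq_zero.1 hlast, ht]; field_simp
  · -- move within the zero set of `v` in the coordinate directions `j` and `k₀`
    have key : ∀ u : Fin (p + 1) → ℚ,
        affVal u (Pi.single k₀ t + (Pi.single j (v k₀.castSucc) - Pi.single k₀ (v j.castSucc)) :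
          Fin p → ℚ) = u (Fin.last p) - u k₀.castSucc * t -
            (u j.castSucc * v k₀.castSucc - u k₀.castSucc * v j.castSucc) := fun u => by
      simp only [affVal, Pi.add_apply, Pi.sub_apply, mul_add, mul_sub, Finset.sum_add_distrib,
        Finset.sum_sub_distrib, Rat.cast_id]
      simp [Pi.single_apply]
      ring
    have h1 := h _ (by
      rw [key]; rw [affVal_single] at hb; simp only [Rat.cast_id] at hb
      rw [hb]; ring)
    rw [key, hlast] at h1
    simp only [Pi.smul_apply, smul_eq_mul]
    field_simp
    linarith

theorem tendsto_affVal_lineMap (v : Fin (p + 1) → ℚ) (β d : Fin p → ℚ) :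
    Tendsto (fun s : ℚ => affVal v (β + s • (d - β))) (𝓝 0) (𝓝 (affVal v β)) := by
  simp only [affVal_lineMap]
  have : ContinuousAt (fun s : ℚ => (1 - s) * affVal v β + s * affVal v d) 0 := by fun_prop
  simpa [ContinuousAt] using this

/-- Finitely many strict inequalities survive a small perturbation that makes finitely many
nonzero affine functions nonzero. -/
theorem exists_generic (P N : Finset (Fin (p + 1) → ℚ)) (β : Fin p → ℚ)
    (hP : ∀ v ∈ P, 0 < affVal v β) (hN : ∀ v ∈ N, v ≠ 0) :
    ∃ β' : Fin p → ℚ, (∀ v ∈ P, 0 < affVal v β') ∧ ∀ v ∈ N, affVal v β' ≠ 0 := by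
  classical
  induction N using Finset.induction_on with
  | empty => exact ⟨β, hP, by simp⟩
  | insert w N _ ih =>
    obtain ⟨β', h1, h2⟩ := ih fun v hv => hN v (Finset.mem_insert_of_mem hv)
    by_cases hw : affVal w β' = 0
    · obtain ⟨d, hd⟩ := exists_affVal_ne_zero (K := ℚ) (hN w (Finset.mem_insert_self _ _))
      -- `w` vanishes at `β'`: a small step towards a nonzero of `w` keeps what has been achieved
      have e1 : ∀ᶠ s : ℚ in 𝓝 0, ∀ v ∈ P, 0 < affVal v (β' + s • (d - β')) :=
        (Finset.eventually_all P).2 fun v hv =>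
          (tendsto_affVal_lineMap v β' d).eventually (lt_mem_nhds (h1 v hv))
      have e2 : ∀ᶠ s : ℚ in 𝓝 0, ∀ v ∈ N, affVal v (β' + s • (d - β')) ≠ 0 :=
        (Finset.eventually_all N).2 fun v hv =>
          (tendsto_affVal_lineMap v β' d).eventually_ne (h2 v hv)
      have e3 : ∀ᶠ s : ℚ in 𝓝[>] 0, 0 < s := eventually_mem_nhdsWithin
      obtain ⟨s, ⟨h1', h2'⟩, hs⟩ :=
        (((e1.and e2).filter_mono nhdsWithin_le_nhds).and e3).exists
      refine ⟨_, h1', fun v hv => ?_⟩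
      rcases Finset.mem_insert.1 hv with rfl | hv
      · rw [affVal_lineMap, hw, mul_zero, zero_add]
        exact mul_ne_zero hs.ne' hd
      · exact h2' v hv
    · refine ⟨β', h1, fun v hv => ?_⟩
      rcases Finset.mem_insert.1 hv with rfl | hv
      · exact hw
      · exact h2 v hv

/-- Two coefficient vectors are nonzero multiples of each other. -/
def Proportional (v w : Fin (p + 1) → ℚ) : Prop := ∃ c : ℚ, c ≠ 0 ∧ w = c • v

theorem Proportional.refl (v : Fin (p + 1) → ℚ) : Proportional v v := ⟨1, one_ne_zero, by simp⟩

theorem Proportional.symm {v w : Fin (p + 1) → ℚ} (h : Proportional v w) :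
    Proportional w v := by
  obtain ⟨c, hc, rfl⟩ := h
  exact ⟨c⁻¹, inv_ne_zero hc, by rw [smul_smul, inv_mul_cancel₀ hc, one_smul]⟩

theorem Proportional.trans {u v w : Fin (p + 1) → ℚ} (h : Proportional u v)
    (h' : Proportional v w) : Proportional u w := by
  obtain ⟨c, hc, rfl⟩ := h
  obtain ⟨d, hd, rfl⟩ := h'
  exact ⟨d * c, mul_ne_zero hd hc, by rw [smul_smul]⟩

theorem proportional_of_eq_smul {v w : Fin (p + 1) → ℚ} {c : ℚ} (hw : w ≠ 0) (h : w = c • v) :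
    Proportional v w :=
  ⟨c, fun hc => hw (by rw [h, hc, zero_smul]), h⟩

end Affine

/-! ### The hyperplanes of the arrangement -/

section Hyperplanes

variable {n p : ℕ} {X : Fin n → Fin p → ℚ} {y : Fin n → ℚ}

theorem row_castSucc (i : Fin n) (k : Fin p) : row X y i k.castSucc = X i k := by
  simp [row]

theorem row_last (i : Fin n) : row X y i (Fin.last p) = y i := by simp [row]

theorem diffVec_swap (i j : Fin n) : diffVec X y j i = -diffVec X y i j := by simp [diffVec]

theorem diffVec_proportional_swap (i j : Fin n) :
    Proportional (diffVec X y i j) (diffVec X y j i) :=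
  ⟨-1, by norm_num, by rw [diffVec_swap]; simp⟩

theorem row_injective (hd : DistinctRows X y) : Function.Injective (row X y) := by
  intro i j h
  refine hd i j (funext fun k => ?_) ?_
  · simpa [row_castSucc] using congrFun h k.castSucc
  · simpa [row_last] using congrFun h (Fin.last p)

theorem diffVec_ne_zero (hd : DistinctRows X y) {i j : Fin n} (h : i ≠ j) :
    diffVec X y i j ≠ 0 :=
  sub_ne_zero.2 fun h' => h (row_injective hd h')

theorem residual_lt_iff {β : Fin p → ℚ} {i j : Fin n} :
    residual X y β i < residual X y β j ↔ 0 < affVal (diffVec X y j i) β := by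
  rw [affVal_diffVec, sub_pos]

theorem residual_eq_iff {β : Fin p → ℚ} {i j : Fin n} :
    residual X y β i = residual X y β j ↔ affVal (diffVec X y i j) β = 0 := by
  rw [affVal_diffVec, sub_eq_zero]

theorem mem_hyperplane_iff {β : Fin p → ℝ} {i j : Fin n} :
    β ∈ hyperplane X y i j ↔ affVal (diffVec X y i j) β = 0 := by
  rw [affVal_diffVec, sub_eq_zero]; rfl

theorem affVal_ratCast (v : Fin (p + 1) → ℚ) (β : Fin p → ℚ) :
    affVal v (fun k => (β k : ℝ)) = ((affVal v β : ℚ) : ℝ) := by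
  simp [affVal]

theorem residual_ratCast (β : Fin p → ℚ) (i : Fin n) :
    residual X y (fun k => (β k : ℝ)) i = ((residual X y β i : ℚ) : ℝ) := by
  rw [← affVal_row, ← affVal_row, affVal_ratCast]

theorem exists_coeff_ne_zero {v : Fin (p + 1) → ℚ} {β : Fin p → ℚ} (hv : v ≠ 0)
    (h : affVal v β = 0) : ∃ k : Fin p, v k.castSucc ≠ 0 := by
  by_contra! h0
  have : v (Fin.last p) = 0 := by simpa [affVal, h0] using h
  exact hv (funext fun k => Fin.lastCases this h0 k)

theorem proportional_of_zeros_eq {v w : Fin (p + 1) → ℚ} (hv : v ≠ 0) (hw : w ≠ 0)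
    (h : ∀ β : Fin p → ℚ, affVal v β = 0 ↔ affVal w β = 0) : Proportional v w := by
  by_cases hk : ∃ k : Fin p, v k.castSucc ≠ 0
  · obtain ⟨k, hk⟩ := hk
    obtain ⟨c, hc⟩ := exists_eq_smul_of_zeros_subset hk fun β => (h β).1
    exact proportional_of_eq_smul hw hc
  by_cases hk' : ∃ k : Fin p, w k.castSucc ≠ 0
  · obtain ⟨k, hk'⟩ := hk'
    obtain ⟨c, hc⟩ := exists_eq_smul_of_zeros_subset hk' fun β => (h β).2
    exact (proportional_of_eq_smul hv hc).symm
  -- two constant functions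
  push Not at hk hk'
  have hl : v (Fin.last p) ≠ 0 := fun h0 => hv (funext fun k => Fin.lastCases h0 hk k)
  refine proportional_of_eq_smul (c := w (Fin.last p) / v (Fin.last p)) hw (funext fun k => ?_)
  refine Fin.lastCases ?_ (fun j => ?_) k
  · simp [hl]
  · simp [hk, hk']

/-- If the linear parts vanish, then both hyperplanes are empty and both vectors are nonzero
multiples of the last unit vector; so the equivalence includes this case. -/
theorem hyperplane_eq_iff (hd : DistinctRows X y) {i j k l : Fin n} (hij : i ≠ j)
    (hkl : k ≠ l) :
    hyperplane X y i j = hyperplane X y k l ↔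
      Proportional (diffVec X y i j) (diffVec X y k l) := by
  constructor
  · intro h
    refine proportional_of_zeros_eq (diffVec_ne_zero hd hij) (diffVec_ne_zero hd hkl) fun β => ?_
    have := Set.ext_iff.1 h fun k => (β k : ℝ)
    rw [mem_hyperplane_iff, mem_hyperplane_iff, affVal_ratCast, affVal_ratCast] at this
    exact_mod_cast this
  · rintro ⟨c, hc, h⟩
    ext β
    rw [mem_hyperplane_iff, mem_hyperplane_iff, h, affVal_smul]
    simp [hc]

theorem mem_redundantPairs_iff (hd : DistinctRows X y) {e : Fin n × Fin n} :
    e ∈ redundantPairs X y ↔ e.1 < e.2 ∧ ∃ i j : Fin n, i < j ∧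
      Proportional (diffVec X y i j) (diffVec X y e.1 e.2) ∧ toLex (i, j) < toLex e := by
  refine and_congr_right fun he => exists₂_congr fun i j => and_congr_right fun hij => ?_
  rw [hyperplane_eq_iff hd hij.ne he.ne]

/-- Each class of pairs with the same hyperplane has a representative that is not redundant. -/
theorem exists_nonredundant (hd : DistinctRows X y) {a b : Fin n} (hab : a ≠ b) :
    ∃ e : Fin n × Fin n, e.1 < e.2 ∧ e ∉ redundantPairs X y ∧
      Proportional (diffVec X y a b) (diffVec X y e.1 e.2) := by
  let s : Set (Fin n ×ₗ Fin n) := {e | (ofLex e).1 < (ofLex e).2 ∧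
    Proportional (diffVec X y a b) (diffVec X y (ofLex e).1 (ofLex e).2)}
  have hs : s.Nonempty := by
    rcases hab.lt_or_gt with h | h
    · exact ⟨toLex (a, b), h, .refl _⟩
    · exact ⟨toLex (b, a), h, diffVec_proportional_swap _ _⟩
  obtain ⟨e, ⟨h1, h2⟩, h3⟩ :=
    (wellFounded_lt : WellFounded ((· < ·) : Fin n ×ₗ Fin n → _ → Prop)).has_min s hs
  refine ⟨ofLex e, h1, fun h => ?_, h2⟩
  obtain ⟨-, i, j, hij, hp, hlt⟩ := (mem_redundantPairs_iff hd).1 h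
  exact h3 (toLex (i, j)) ⟨hij, h2.trans hp.symm⟩ hlt

end Hyperplanes

/-! ### Facets of a cell -/

section Facets

variable {n p : ℕ} {X : Fin n → Fin p → ℚ} {y : Fin n → ℚ}

/-- For `β` in the interior of a cell, `w` is a relative interior point of the facet of that cell
that lies in the hyperplane of the pair `e`: the two residuals of `e` agree at `w`, and every pair
with another hyperplane is ordered strictly at `w`, in the same way as at `β`. -/
def IsFacetPoint (X : Fin n → Fin p → ℚ) (y : Fin n → ℚ) (β : Fin p → ℚ) (e : Fin n × Fin n)
    (w : Fin p → ℚ) : Prop :=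
  residual X y w e.1 = residual X y w e.2 ∧
    ∀ a b : Fin n, residual X y β a < residual X y β b →
      ¬ Proportional (diffVec X y e.1 e.2) (diffVec X y a b) →
        residual X y w a < residual X y w b

/-- `β` and `z` lie strictly on different sides of the hyperplane of `e`. -/
def Separates (X : Fin n → Fin p → ℚ) (y : Fin n → ℚ) (e : Fin n × Fin n) (β z : Fin p → ℚ) :
    Prop :=
  (residual X y β e.1 < residual X y β e.2 ∧ residual X y z e.2 < residual X y z e.1) ∨
    (residual X y β e.2 < residual X y β e.1 ∧ residual X y z e.1 < residual X y z e.2)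

theorem separates_iff {e : Fin n × Fin n} {β z : Fin p → ℚ} :
    Separates X y e β z ↔
      affVal (diffVec X y e.1 e.2) β * affVal (diffVec X y e.1 e.2) z < 0 := by
  rw [mul_neg_iff, affVal_diffVec, affVal_diffVec, Separates, sub_pos, sub_pos, sub_neg, sub_neg]
  tauto

theorem Separates.of_proportional {e f : Fin n × Fin n} {β z : Fin p → ℚ}
    (h : Separates X y e β z) (hp : Proportional (diffVec X y e.1 e.2) (diffVec X y f.1 f.2)) :
    Separates X y f β z := by
  obtain ⟨c, hc, hp⟩ := hp
  rw [separates_iff] at h ⊢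
  rw [hp, affVal_smul, affVal_smul]
  have : 0 < c * c := mul_self_pos.2 hc
  simp only [Rat.cast_id]
  nlinarith

/-- Every point `z` outside a cell is separated from it by one of its facets. A perturbation within
the cell of its point `β` makes sure that the segment to `z` meets different hyperplanes at different
points; then the first one that it crosses is that of a facet, and `e` is the nonredundant pair of
this hyperplane. -/
theorem exists_separating_facet (hd : DistinctRows X y) {β z : Fin p → ℚ} {a b : Fin n}
    (hab : residual X y β a < residual X y β b) (hz : residual X y z b < residual X y z a) :
    ∃ e : Fin n × Fin n, e.1 < e.2 ∧ e ∉ redundantPairs X y ∧ Separates X y e β z ∧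
      ∃ w, IsFacetPoint X y β e w := by
  classical
  -- `F q` is the coefficient vector of `r_{q.2} - r_{q.1}`
  let F : Fin n × Fin n → Fin (p + 1) → ℚ := fun q => diffVec X y q.2 q.1
  let P : Finset (Fin (p + 1) → ℚ) :=
    (Finset.univ.filter fun q : Fin n × Fin n => 0 < affVal (F q) β).image F
  -- avoiding the zeros of these functions, no two different hyperplanes are met at the same time
  let N : Finset (Fin (p + 1) → ℚ) :=
    (Finset.univ.filter fun q : (Fin n × Fin n) × (Fin n × Fin n) =>
      affVal (F q.1) z ≠ 0 ∧ q.2.1 ≠ q.2.2 ∧ ¬ Proportional (F q.1) (F q.2)).image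
        fun q => affVal (F q.2) z • F q.1 - affVal (F q.1) z • F q.2
  obtain ⟨β₁, hP, hN⟩ := exists_generic P N β (by
      intro v hv
      obtain ⟨q, hq, rfl⟩ := Finset.mem_image.1 hv
      exact (Finset.mem_filter.1 hq).2) (by
      intro v hv h0
      obtain ⟨q, hq, rfl⟩ := Finset.mem_image.1 hv
      obtain ⟨-, h1, h2, h3⟩ := Finset.mem_filter.1 hq
      refine h3 (proportional_of_eq_smul (c := affVal (F q.2) z / affVal (F q.1) z)
        (diffVec_ne_zero hd h2.symm) ?_)
      have : affVal (F q.1) z • F q.2 = affVal (F q.2) z • F q.1 := (sub_eq_zero.1 h0).symm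
      rw [div_eq_inv_mul, ← smul_smul, ← this, smul_smul, inv_mul_cancel₀ h1, one_smul])
  have hP' : ∀ q : Fin n × Fin n, 0 < affVal (F q) β → 0 < affVal (F q) β₁ := fun q hq =>
    hP _ (Finset.mem_image_of_mem _ (Finset.mem_filter.2 ⟨Finset.mem_univ _, hq⟩))
  -- the pairs whose order changes, and the first one among them
  let Q : Finset (Fin n × Fin n) :=
    Finset.univ.filter fun q => 0 < affVal (F q) β ∧ affVal (F q) z < 0
  have hQ : Q.Nonempty := by
    refine ⟨(a, b), Finset.mem_filter.2 ⟨Finset.mem_univ _, residual_lt_iff.1 hab, ?_⟩⟩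
    change affVal (diffVec X y b a) z < 0
    rw [affVal_diffVec]; linarith
  -- the parameter of the point of the segment at which the order of the pair `q` changes
  let T : Fin n × Fin n → ℚ := fun q => affVal (F q) β₁ / (affVal (F q) β₁ - affVal (F q) z)
  obtain ⟨q₀, hq₀, hmin⟩ := Q.exists_min_image T hQ
  obtain ⟨-, hq₀β, hq₀z⟩ := Finset.mem_filter.1 hq₀
  set t := T q₀ with ht
  have hq₀1 := hP' q₀ hq₀β
  have hTmul : ∀ q, 0 < affVal (F q) β₁ → affVal (F q) z < 0 →
      T q * (affVal (F q) β₁ - affVal (F q) z) = affVal (F q) β₁ := fun q h1 h2 =>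
    div_mul_cancel₀ _ (by linarith)
  have ht0 : 0 < t := div_pos hq₀1 (by linarith)
  have ht1 : t < 1 := (div_lt_one (by linarith)).2 (by linarith)
  have h0 : (1 - t) * affVal (F q₀) β₁ + t * affVal (F q₀) z = 0 := by
    have := hTmul q₀ hq₀1 hq₀z
    linarith
  obtain ⟨e, he, heR, hep⟩ := exists_nonredundant hd
    (show q₀.2 ≠ q₀.1 from fun h => by simp [F, h, diffVec, affVal] at hq₀z)
  have hsep : Separates X y e β z :=
    Separates.of_proportional (e := (q₀.2, q₀.1))
      (separates_iff.2 (mul_neg_of_pos_of_neg hq₀β hq₀z)) hep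
  refine ⟨e, he, heR, hsep, β₁ + t • (z - β₁), ?_, fun a b hab hnp => ?_⟩
  · obtain ⟨c, -, hc⟩ := hep
    rw [residual_eq_iff, hc, affVal_smul, affVal_lineMap]
    exact mul_eq_zero_of_right _ h0
  · rw [residual_lt_iff, affVal_lineMap]
    have hβ₁ : 0 < affVal (F (a, b)) β₁ := hP' (a, b) (residual_lt_iff.1 hab)
    change 0 < (1 - t) * affVal (F (a, b)) β₁ + t * affVal (F (a, b)) z
    rcases le_or_gt 0 (affVal (F (a, b)) z) with hz' | hz'
    · have : 0 < (1 - t) * affVal (F (a, b)) β₁ := mul_pos (by linarith) hβ₁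
      have := mul_nonneg ht0.le hz'
      linarith
    · have hm := hmin (a, b) (Finset.mem_filter.2
        ⟨Finset.mem_univ _, residual_lt_iff.1 hab, hz'⟩)
      have hmul := hTmul (a, b) hβ₁ hz'
      have hle : t * (affVal (F (a, b)) β₁ - affVal (F (a, b)) z) ≤ affVal (F (a, b)) β₁ := by
        refine le_trans (mul_le_mul_of_nonneg_right hm ?_) hmul.le
        linarith only [hβ₁, hz']
      refine lt_of_le_of_ne (by linarith) fun heq => ?_
      refine hN (affVal (F (a, b)) z • F q₀ - affVal (F q₀) z • F (a, b))
        (Finset.mem_image.2 ⟨(q₀, (a, b)), Finset.mem_filter.2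
          ⟨Finset.mem_univ _, hq₀z.ne, fun h => ?_, fun h => ?_⟩, rfl⟩) ?_
      · have h' : a = b := h
        rw [h'] at hab
        exact lt_irrefl _ hab
      · exact hnp ((hep.symm.trans h).trans (diffVec_proportional_swap _ _))
      · rw [affVal_sub, affVal_smul, affVal_smul]
        simp only [Rat.cast_id]
        have h1t : (1 - t) ≠ 0 := by linarith
        apply mul_left_cancel₀ h1t
        linear_combination affVal (F (a, b)) z * h0 + affVal (F q₀) z * heq

/-- This is where the numbering of the rows enters: a row strictly between the rows of a
nonredundant pair would yield a lexicographically smaller pair with the same hyperplane. -/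
theorem row_ne_convex_combination (hd : DistinctRows X y) (ha : AdmissibleNumbering X y)
    {e : Fin n × Fin n} (he : e.1 < e.2) (heR : e ∉ redundantPairs X y) (hX : X e.1 ≠ X e.2)
    {c : ℚ} (h0 : 0 < c) (h1 : c < 1) (m : Fin n) :
    row X y m ≠ (1 - c) • row X y e.1 + c • row X y e.2 := by
  intro hm
  have hseg : (X m, y m) ∈ openSegment ℚ (X e.1, y e.1) (X e.2, y e.2) := by
    refine ⟨1 - c, c, by linarith, h0, by ring, ?_⟩
    refine Prod.ext (funext fun k => ?_) ?_
    · have := congrFun hm k.castSucc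
      simp only [Pi.add_apply, Pi.smul_apply, row_castSucc] at this
      simpa using this.symm
    · have := congrFun hm (Fin.last p)
      simp only [Pi.add_apply, Pi.smul_apply, row_last] at this
      simpa using this.symm
  have hm2 : m ≠ e.2 := by
    rintro rfl
    have : (1 - c) • diffVec X y e.1 e.2 = 0 := by
      rw [diffVec, smul_sub, sub_eq_zero]
      refine add_right_cancel (b := c • row X y e.2) (hm.symm.trans ?_)
      rw [← add_smul, sub_add_cancel, one_smul]
    rcases smul_eq_zero.1 this with h | h
    · linarith
    · exact diffVec_ne_zero hd he.ne h
  have hdm : diffVec X y e.1 m = c • diffVec X y e.1 e.2 := by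
    rw [diffVec, hm, diffVec, sub_smul, one_smul, smul_sub]; abel
  have hm1 : m ≠ e.1 := by
    rintro rfl
    have : c • diffVec X y e.1 e.2 = 0 := by rw [← hdm]; simp [diffVec]
    rcases smul_eq_zero.1 this with h | h
    · linarith
    · exact diffVec_ne_zero hd he.ne h
  have hpr : Proportional (diffVec X y e.1 m) (diffVec X y e.1 e.2) :=
    Proportional.symm ⟨c, h0.ne', hdm⟩
  rcases lt_or_gt_of_ne hm2 with hlt | hgt
  · refine heR ((mem_redundantPairs_iff hd).2 ⟨he, ?_⟩)
    rcases lt_or_gt_of_ne hm1 with hlt1 | hgt1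
    · exact ⟨m, e.1, hlt1, (diffVec_proportional_swap _ _).trans hpr,
        Prod.Lex.toLex_lt_toLex.2 (Or.inl hlt1)⟩
    · exact ⟨e.1, m, hgt1, hpr, Prod.Lex.toLex_lt_toLex.2 (Or.inr ⟨rfl, hlt⟩)⟩
  · exact ha e.1 e.2 m he hgt hX hseg

theorem IsFacetPoint.eq_of_proportional {β w : Fin p → ℚ} {e : Fin n × Fin n}
    (h : IsFacetPoint X y β e w) {a b : Fin n}
    (hp : Proportional (diffVec X y e.1 e.2) (diffVec X y a b)) :
    residual X y w a = residual X y w b := by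
  obtain ⟨c, -, hc⟩ := hp
  rw [residual_eq_iff, hc, affVal_smul, residual_eq_iff.1 h.1, mul_zero]

/-- The nonredundant pair of the hyperplane of a facet is adjacent in the order of the residuals
in the cell. -/
theorem IsFacetPoint.not_between (hd : DistinctRows X y) (ha : AdmissibleNumbering X y)
    {β w : Fin p → ℚ} {e : Fin n × Fin n} (he : e.1 < e.2) (heR : e ∉ redundantPairs X y)
    (hw : IsFacetPoint X y β e w) {k l m : Fin n} (hkl : e = (k, l) ∨ e = (l, k))
    (hkm : residual X y β k < residual X y β m) (hml : residual X y β m < residual X y β l) :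
    False := by
  have hwkl : residual X y w k = residual X y w l := by
    rcases hkl with rfl | rfl
    · exact hw.1
    · exact hw.1.symm
  have hne : k ≠ l := by rintro rfl; exact lt_irrefl _ (hkm.trans hml)
  have hX : X k ≠ X l := by
    intro h
    refine hne (hd k l h ?_)
    simpa [residual, h] using hwkl
  have hp : Proportional (diffVec X y e.1 e.2) (diffVec X y k l) := by
    rcases hkl with rfl | rfl
    · exact .refl _
    · exact diffVec_proportional_swap _ _
  have hpm : Proportional (diffVec X y k l) (diffVec X y k m) := by
    by_contra hn
    have h1 := hw.2 k m hkm fun h => hn (hp.symm.trans h)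
    by_cases h2 : Proportional (diffVec X y e.1 e.2) (diffVec X y m l)
    · have := hw.eq_of_proportional h2
      linarith
    · have := hw.2 m l hml h2
      linarith
  obtain ⟨c, -, hc⟩ := hpm
  have hval : residual X y β k - residual X y β m =
      c * (residual X y β k - residual X y β l) := by
    have := congrArg (fun v => affVal v β) hc
    simpa [affVal_smul, affVal_diffVec] using this
  have hc0 : 0 < c := by
    by_contra! h
    nlinarith
  have hc1 : c < 1 := by
    by_contra! h
    nlinarith
  have hrow : row X y m = (1 - c) • row X y k + c • row X y l := by
    have : row X y m = row X y k - diffVec X y k m := by simp [diffVec]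
    rw [this, hc, diffVec, sub_smul, one_smul, smul_sub]; abel
  rcases hkl with rfl | rfl
  · exact row_ne_convex_combination hd ha he heR hX hc0 hc1 m hrow
  · refine row_ne_convex_combination hd ha he heR hX.symm (c := 1 - c) (by linarith)
      (by linarith) m ?_
    rw [hrow]
    rw [sub_sub_cancel]
    exact add_comm _ _

end Facets

/-! ### Sorting the residuals -/

section Sorting

variable {n p : ℕ} {X : Fin n → Fin p → ℚ} {y : Fin n → ℚ}

/-- The residuals at `z`, in the order given by `f`, increase strictly. -/
def SortedAt (X : Fin n → Fin p → ℚ) (y : Fin n → ℚ) (z : Fin p → ℚ) (f : Fin n → Fin n) : Prop :=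
  StrictMono fun i => residual X y z (f i)

theorem SortedAt.injective {z : Fin p → ℚ} {f : Fin n → Fin n} (h : SortedAt X y z f) :
    Function.Injective f :=
  Function.Injective.of_comp (f := residual X y z) (StrictMono.injective h)

theorem SortedAt.surjective {z : Fin p → ℚ} {f : Fin n → Fin n} (h : SortedAt X y z f) :
    Function.Surjective f :=
  Finite.surjective_of_injective h.injective

theorem SortedAt.residual_injective {z : Fin p → ℚ} {f : Fin n → Fin n} (h : SortedAt X y z f) :
    Function.Injective (residual X y z) := by
  intro a b hab
  obtain ⟨i, rfl⟩ := h.surjective a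
  obtain ⟨j, rfl⟩ := h.surjective b
  rw [StrictMono.injective h hab]

theorem SortedAt.residual_lt_iff {z : Fin p → ℚ} {f : Fin n → Fin n} (h : SortedAt X y z f)
    {i j : Fin n} : residual X y z (f i) < residual X y z (f j) ↔ i < j :=
  StrictMono.lt_iff_lt h

/-- The order of the residuals at a point is determined by the permutation that sorts them. -/
theorem SortedAt.lt_iff_lt {z z' : Fin p → ℚ} {f : Fin n → Fin n} (h : SortedAt X y z f)
    (h' : SortedAt X y z' f) (a b : Fin n) :
    residual X y z a < residual X y z b ↔ residual X y z' a < residual X y z' b := by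
  obtain ⟨i, rfl⟩ := h.surjective a
  obtain ⟨j, rfl⟩ := h.surjective b
  rw [h.residual_lt_iff, h'.residual_lt_iff]

theorem SortedAt.congr {z z' : Fin p → ℚ} {f : Fin n → Fin n} (h : SortedAt X y z f)
    (h' : ∀ a b, residual X y z a < residual X y z b → residual X y z' a < residual X y z' b) :
    SortedAt X y z' f :=
  fun _ _ hij => h' _ _ (h hij)

theorem SortedAt.unique {z : Fin p → ℚ} {f g : Fin n → Fin n} (hf : SortedAt X y z f)
    (hg : SortedAt X y z g) : f = g := by
  have h : Set.range (fun i => residual X y z (f i)) = Set.range fun i => residual X y z (g i) := by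
    rw [Set.range_comp' (residual X y z) f, Set.range_comp' (residual X y z) g,
      hf.surjective.range_eq, hg.surjective.range_eq]
  have := (StrictMono.range_inj hf hg).1 h
  funext i
  exact hf.residual_injective (congrFun this i)

theorem residuals_val (β : Fin p → ℚ) : (residuals X y β).val = residual X y β := by
  funext i
  simp [residuals, residual]

/-- The sorted list of indices in `sortResiduals`. -/
def sortedIndices (X : Fin n → Fin p → ℚ) (y : Fin n → ℚ) (β : Fin p → ℚ) : List (Fin n) :=
  (mergeSort (fun i j => tick (decide (residual X y β i ≤ residual X y β j)))
    (List.finRange n)).val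

theorem sortedIndices_perm (β : Fin p → ℚ) :
    (sortedIndices X y β).Perm (List.finRange n) := mergeSort_perm _ _

theorem sortedIndices_length (β : Fin p → ℚ) : (sortedIndices X y β).length = n := by
  rw [(sortedIndices_perm β).length_eq, List.length_finRange]

theorem sortResiduals_val (β : Fin p → ℚ) (i : Fin n) :
    (sortResiduals X y β).val i =
      (sortedIndices X y β)[(i : ℕ)]'(by rw [sortedIndices_length]; exact i.2) := by
  simp only [sortResiduals, reserving_val, bind_val, tabulate_val, tick_val, residuals_val]
  change ((sortedIndices X y β)[(i : ℕ)]?).getD i = _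
  rw [List.getElem?_eq_getElem (by rw [sortedIndices_length]; exact i.2)]
  rfl

theorem sortResiduals_injective (β : Fin p → ℚ) :
    Function.Injective (sortResiduals X y β).val := by
  intro i j h
  rw [sortResiduals_val, sortResiduals_val] at h
  have hn : (sortedIndices X y β).Nodup :=
    (sortedIndices_perm β).nodup_iff.2 (List.nodup_finRange n)
  exact Fin.ext ((hn.getElem_inj_iff).1 h)

theorem sortResiduals_sortedAt {β : Fin p → ℚ} (hβ : Function.Injective (residual X y β)) :
    SortedAt X y β (sortResiduals X y β).val := by
  intro i j hij
  refine lt_of_le_of_ne ?_ fun h => hij.ne (sortResiduals_injective β (hβ h))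
  have hs : (sortedIndices X y β).Pairwise fun a b => residual X y β a ≤ residual X y β b :=
    mergeSort_pairwise (by simp) _
  simp only [sortResiduals_val]
  exact List.pairwise_iff_getElem.1 hs i j _ _ hij

end Sorting

/-! ### The tightness test -/

section Tightness

variable {n p : ℕ} {X : Fin n → Fin p → ℚ} {y : Fin n → ℚ}

/-- A loop that pushes some entries onto a list produces the selected entries in reverse order. -/
theorem foldl_cons_eq_filterMap {α ι : Type} (g : ι → Option α) (l : List ι) (s : List α) :
    l.foldl (fun s i => (g i).elim s (· :: s)) s = (l.filterMap g).reverse ++ s := by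
  induction l generalizing s with
  | nil => simp
  | cons i l ih =>
    cases h : g i <;> simp [ih, h]

theorem constraintRow_val (t : ℚ) (a b : Fin n) :
    (constraintRow X y t a b).val =
      ((Fin.snoc (fun k => X b k - X a k) t : Fin (p + 1) → ℚ), y b - y a) := rfl

theorem sum_constraintRow (t : ℚ) (a b : Fin n) (z : Fin (p + 1) → ℚ) :
    ∑ k, (constraintRow X y t a b).val.1 k * z k = y b - y a + t * z (Fin.last p) +
      (residual X y (Fin.init z) a - residual X y (Fin.init z) b) := by
  rw [constraintRow_val, Fin.sum_univ_castSucc]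
  simp only [Fin.snoc_castSucc, Fin.snoc_last, residual, Fin.init, Rat.cast_id, sub_mul,
    Finset.sum_sub_distrib]
  ring

/-- The constraint of `tightnessLP` for the positions `m` and `m + 1`, if there is one. -/
def tightnessRow (X : Fin n → Fin p → ℚ) (y : Fin n → ℚ) (R : Finset (Fin n × Fin n))
    (π : Fin n → Fin n) (k l : Fin n) (m : Fin n) : Option ((Fin (p + 1) → ℚ) × ℚ) :=
  if h : (m : ℕ) + 1 < n then
    if orderedPair (π m) (π ⟨m + 1, h⟩) ∉ insert (k, l) R then
      some (constraintRow X y 1 (π m) (π ⟨m + 1, h⟩)).val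
    else none
  else none

/-- The coefficient vector of the variable `ε`. -/
def lastUnit (p : ℕ) : Fin (p + 1) → ℚ := fun m => if m = Fin.last p then 1 else 0

theorem tightnessLP_val (R : Finset (Fin n × Fin n)) (π : Fin n → Fin n) (k l : Fin n) :
    (tightnessLP X y R π k l).val =
      { obj := lastUnit p
        ineqs := (lastUnit p, 1) :: ((List.finRange n).filterMap (tightnessRow X y R π k l)).reverse
        eqs := [(constraintRow X y 0 k l).val] } := by
  have h := foldl_cons_eq_filterMap (tightnessRow X y R π k l) (List.finRange n) []
  rw [List.append_nil] at h
  simp only [tightnessLP, bind_val, tick_val, loop_val]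
  rw [← h]
  congr 3
  funext s m
  unfold tightnessRow
  split_ifs <;> rfl

theorem sum_lastUnit (z : Fin (p + 1) → ℚ) : ∑ k, lastUnit p k * z k = z (Fin.last p) := by
  simp [lastUnit]

/-- `w` satisfies the equation and, strictly, the remaining inequalities of the tightness test. -/
def PassesTest (X : Fin n → Fin p → ℚ) (y : Fin n → ℚ) (R : Finset (Fin n × Fin n))
    (π : Fin n → Fin n) (e : Fin n × Fin n) (w : Fin p → ℚ) : Prop :=
  residual X y w e.1 = residual X y w e.2 ∧ ∀ (m : ℕ) (h : m + 1 < n),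
    orderedPair (π ⟨m, by omega⟩) (π ⟨m + 1, h⟩) ∉ insert e R →
      residual X y w (π ⟨m, by omega⟩) < residual X y w (π ⟨m + 1, h⟩)

theorem tightnessLP_feasible_iff (R : Finset (Fin n × Fin n)) (π : Fin n → Fin n) (k l : Fin n)
    (z : Fin (p + 1) → ℚ) :
    (tightnessLP X y R π k l).val.Feasible z ↔ z (Fin.last p) ≤ 1 ∧
      (∀ (m : ℕ) (h : m + 1 < n),
        orderedPair (π ⟨m, by omega⟩) (π ⟨m + 1, h⟩) ∉ insert (k, l) R →
          residual X y (Fin.init z) (π ⟨m, by omega⟩) + z (Fin.last p) ≤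
            residual X y (Fin.init z) (π ⟨m + 1, h⟩)) ∧
      residual X y (Fin.init z) k = residual X y (Fin.init z) l := by
  rw [tightnessLP_val, LP.Feasible]
  simp only [List.forall_mem_cons, List.mem_reverse, List.mem_filterMap, sum_lastUnit,
    sum_constraintRow, and_assoc, List.not_mem_nil, false_imp_iff, implies_true, and_true,
    List.mem_finRange, true_and]
  refine and_congr_right fun _ => and_congr ?_ ?_
  · constructor
    · intro h m hm he
      have := h (constraintRow X y 1 (π ⟨m, by omega⟩) (π ⟨m + 1, hm⟩)).val ⟨⟨m, by omega⟩, by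
        simp only [tightnessRow]
        rw [dif_pos hm, if_pos he]⟩
      rw [sum_constraintRow, constraintRow_val] at this
      linarith
    · rintro h c ⟨m, hm⟩
      unfold tightnessRow at hm
      split_ifs at hm with h1 h2
      rw [← Option.some.inj hm, sum_constraintRow, constraintRow_val]
      have := h m h1 h2
      simp only [Fin.eta] at this
      linarith
  · rw [constraintRow_val]
    constructor <;> intro h <;> linarith

/-- The slack `ε` of the maximizer is positive, so its inequalities are strict. -/
theorem passesTest_of_tightnessTest {S : LPSolver} {R : Finset (Fin n × Fin n)}
    {π : Fin n → Fin n} {e : Fin n × Fin n} {w : Fin p → ℚ}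
    (h : (tightnessTest S X y R π e.1 e.2).val = some w) : PassesTest X y R π e w := by
  simp only [tightnessTest, reserving_val, bind_val, LPSolver.call] at h
  have hr := S.right (tightnessLP X y R π e.1 e.2).val
  split at h
  · rename_i z hz
    rw [hz] at hr
    split_ifs at h with hpos
    · have hw : Fin.init z = w := Option.some.inj h
      obtain ⟨-, h2, h3⟩ := (tightnessLP_feasible_iff _ _ _ _ _).1 hr.1
      rw [hw] at h2 h3
      refine ⟨h3, fun m hm he => ?_⟩
      have := h2 m hm he
      linarith
    · cases h
  · cases h

/-- A point that passes the test would be feasible with a positive slack; as `ε ≤ 1`, the linear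
program would have a maximizer, and the test would not fail. -/
theorem not_passesTest_of_tightnessTest {S : LPSolver} {R : Finset (Fin n × Fin n)}
    {π : Fin n → Fin n} {e : Fin n × Fin n}
    (h : (tightnessTest S X y R π e.1 e.2).val = none) (w : Fin p → ℚ) :
    ¬ PassesTest X y R π e w := by
  intro hw
  -- a common lower bound `ε` of the slacks
  obtain ⟨ε, hε0, hε1, hε⟩ : ∃ ε : ℚ, 0 < ε ∧ ε ≤ 1 ∧ ∀ (m : ℕ) (h : m + 1 < n),
      orderedPair (π ⟨m, by omega⟩) (π ⟨m + 1, h⟩) ∉ insert e R →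
        residual X y w (π ⟨m, by omega⟩) + ε ≤ residual X y w (π ⟨m + 1, h⟩) := by
    have hfin : ∀ s : Finset (Fin n × Fin n),
        (∀ q ∈ s, residual X y w q.1 < residual X y w q.2) →
        ∃ ε : ℚ, 0 < ε ∧ ε ≤ 1 ∧ ∀ q ∈ s, residual X y w q.1 + ε ≤ residual X y w q.2 := by
      intro s hs
      induction s using Finset.induction_on with
      | empty => exact ⟨1, by norm_num, le_rfl, by simp⟩
      | insert q s _ ih =>
        obtain ⟨ε, h0, h1, h2⟩ := ih fun q hq => hs q (Finset.mem_insert_of_mem hq)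
        have hq := hs q (Finset.mem_insert_self _ _)
        refine ⟨min ε (residual X y w q.2 - residual X y w q.1),
          lt_min h0 (by linarith), (min_le_left _ _).trans h1, fun q' hq' => ?_⟩
        rcases Finset.mem_insert.1 hq' with rfl | hq'
        · have := min_le_right ε (residual X y w q'.2 - residual X y w q'.1)
          linarith
        · have := min_le_left ε (residual X y w q.2 - residual X y w q.1)
          have := h2 q' hq'
          linarith
    classical
    obtain ⟨ε, h0, h1, h2⟩ := hfin
      (Finset.univ.filter fun q => residual X y w q.1 < residual X y w q.2) (by simp)
    exact ⟨ε, h0, h1, fun m hm he => h2 (π ⟨m, by omega⟩, π ⟨m + 1, hm⟩)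
      (Finset.mem_filter.2 ⟨Finset.mem_univ _, hw.2 m hm he⟩)⟩
  have hfeas : (tightnessLP X y R π e.1 e.2).val.Feasible (Fin.snoc w ε) := by
    rw [tightnessLP_feasible_iff, Fin.init_snoc, Fin.snoc_last]
    exact ⟨hε1, hε, hw.1⟩
  have hval : ∀ z, (tightnessLP X y R π e.1 e.2).val.value z = z (Fin.last p) := fun z => by
    rw [tightnessLP_val, LP.value, sum_lastUnit]
  simp only [tightnessTest, reserving_val, bind_val, LPSolver.call] at h
  have hr := S.right (tightnessLP X y R π e.1 e.2).val
  split at h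
  · rename_i z hz
    rw [hz] at hr
    have hle := hr.2 _ hfeas
    rw [hval, hval, Fin.snoc_last] at hle
    rw [if_pos (hε0.trans_le hle)] at h
    cases h
  · rename_i hz
    cases hsolve : S.solve (tightnessLP X y R π e.1 e.2).val with
    | infeasible => rw [hsolve] at hr; exact hr _ hfeas
    | unbounded =>
      rw [hsolve] at hr
      obtain ⟨z, hz1, hz2⟩ := hr 1
      rw [hval] at hz2
      have := ((tightnessLP_feasible_iff _ _ _ _ _).1 hz1).1
      linarith
    | optimal z => exact hz z hsolve

end Tightness

/-! ### The next interior point -/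

section NextPoint

variable {n p : ℕ} {X : Fin n → Fin p → ℚ} {y : Fin n → ℚ}

/-- The running minimum of the parameters `t e > 1` with `C e`: the result `o` is `none` only if
there are no such `e`, and otherwise it is a lower bound `s` of them. The parameter that is computed
from it, the midpoint `(1 + s) / 2` or `2`, exceeds `1` in both cases. -/
theorem foldl_min_spec {ι : Type} (C : ι → Prop) [DecidablePred C] (t : ι → ℚ)
    (hC : ∀ e, C e → 1 < t e) (l : List ι) (o : Option ℚ)
    (ho : l.foldl (fun best e => if C e then some (best.elim (t e) (min (t e))) else best) none =
      o) :
    ∃ s : ℚ, 1 < (o.elim 2 fun u => (1 + u) / 2) ∧ 1 < s ∧ (∀ u, o = some u → s = u) ∧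
      ∀ e ∈ l, C e → o ≠ none ∧ s ≤ t e := by
  subst ho
  induction l using List.reverseRecOn with
  | nil => exact ⟨2, by norm_num, by norm_num, by simp, by simp⟩
  | append_singleton l e ih =>
    obtain ⟨s, -, hs, h1, h2⟩ := ih
    rw [List.foldl_append]
    simp only [List.foldl_cons, List.foldl_nil]
    generalize l.foldl (fun best e => if C e then some (best.elim (t e) (min (t e))) else best)
      none = o at h1 h2
    by_cases he : C e
    · have hte := hC e he
      rw [if_pos he]
      cases o with
      | none =>
        refine ⟨t e, by simp; linarith, hte, by simp, fun e' he' hC' => ⟨by simp, ?_⟩⟩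
        rcases List.mem_append.1 he' with he' | he'
        · exact absurd rfl (h2 e' he' hC').1
        · rw [List.mem_singleton.1 he']
      | some u =>
        obtain rfl := h1 u rfl
        have hm : 1 < min (t e) s := lt_min hte hs
        refine ⟨min (t e) s, by simp only [Option.elim]; linarith, hm, by simp,
          fun e' he' hC' => ⟨by simp, ?_⟩⟩
        rcases List.mem_append.1 he' with he' | he'
        · exact (min_le_right _ _).trans (h2 e' he' hC').2
        · rw [List.mem_singleton.1 he']; exact min_le_left _ _
    · rw [if_neg he]
      refine ⟨s, ?_, hs, h1, fun e' he' hC' => ?_⟩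
      · cases o with
        | none => norm_num
        | some u => rw [← h1 u rfl]; simp only [Option.elim]; linarith
      · rcases List.mem_append.1 he' with he' | he'
        · exact h2 e' he' hC'
        · rw [List.mem_singleton.1 he'] at hC'
          exact absurd hC' he

theorem mem_allPairs (e : Fin n × Fin n) : e ∈ allPairs n := by
  simp only [allPairs]
  exact List.mem_product.2 ⟨List.mem_finRange _, List.mem_finRange _⟩

/-- The new point is beyond `w` on the ray from `β` through `w`, and comes before the next change of
the order of two residuals. -/
theorem exists_nextPoint_eq (β w : Fin p → ℚ) :
    ∃ s : ℚ, 1 < s ∧ (nextPoint X y β w).val = β + s • (w - β) ∧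
      ∀ a b : Fin n, a < b →
        residual X y β a - residual X y β b ≠ residual X y w a - residual X y w b →
        1 < (residual X y β a - residual X y β b) /
          ((residual X y β a - residual X y β b) - (residual X y w a - residual X y w b)) →
        s < (residual X y β a - residual X y β b) /
          ((residual X y β a - residual X y β b) - (residual X y w a - residual X y w b)) := by
  let A : Fin n × Fin n → ℚ := fun e => residual X y β e.1 - residual X y β e.2
  let B : Fin n × Fin n → ℚ := fun e => residual X y w e.1 - residual X y w e.2
  let t : Fin n × Fin n → ℚ := fun e => A e / (A e - B e)
  let C : Fin n × Fin n → Prop := fun e => e.1 < e.2 ∧ A e ≠ B e ∧ 1 < t e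
  have hval : (nextPoint X y β w).val = β + ((((allPairs n).foldl (fun best e =>
      if C e then some (best.elim (t e) (min (t e))) else best) none).elim 2
        fun u => (1 + u) / 2 : ℚ)) • (w - β) := by
    simp only [nextPoint, reserving_val, bind_val, residuals_val, loop_val, tick_val, steps_val]
    change (match (allPairs n).foldl (fun best e =>
      if C e then some (best.elim (t e) (min (t e))) else best) none with
      | some t => _
      | none => _ : Cost (Fin p → ℚ)).val = _
    generalize (allPairs n).foldl (fun best e =>
      if C e then some (best.elim (t e) (min (t e))) else best) none = o
    cases o with
    | none =>
      funext k
      simp only [tabulate_val, steps_val, Option.elim, Pi.add_apply, Pi.smul_apply, Pi.sub_apply,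
        smul_eq_mul]
      ring
    | some u =>
      funext k
      simp only [tabulate_val, steps_val, Option.elim, Pi.add_apply, Pi.smul_apply, Pi.sub_apply,
        smul_eq_mul]
      ring
  obtain ⟨s, h1, h2, h3, h4⟩ := foldl_min_spec C t (fun e he => he.2.2) (allPairs n) _ rfl
  refine ⟨_, h1, hval, fun a b hab hne hlt => ?_⟩
  obtain ⟨h5, h6⟩ := h4 (a, b) (mem_allPairs _) ⟨hab, hne, hlt⟩
  obtain ⟨u, hu⟩ := Option.ne_none_iff_exists'.1 h5
  rw [hu]
  obtain rfl := h3 u hu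
  simp only [Option.elim]
  refine lt_of_lt_of_le ?_ h6
  linarith

/-- Passing through a facet reverses exactly the pairs of its hyperplane. -/
theorem nextPoint_order {β w : Fin p → ℚ} {e : Fin n × Fin n} (hw : IsFacetPoint X y β e w)
    {a b : Fin n} (hab : residual X y β a < residual X y β b) :
    (Proportional (diffVec X y e.1 e.2) (diffVec X y a b) →
      residual X y (nextPoint X y β w).val b < residual X y (nextPoint X y β w).val a) ∧
    (¬ Proportional (diffVec X y e.1 e.2) (diffVec X y a b) →
      residual X y (nextPoint X y β w).val a < residual X y (nextPoint X y β w).val b) := by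
  obtain ⟨s, hs, hval, hbound⟩ := exists_nextPoint_eq (X := X) (y := y) β w
  have hres : ∀ i, residual X y (nextPoint X y β w).val i =
      (1 - s) * residual X y β i + s * residual X y w i := fun i => by
    rw [hval, ← affVal_row, affVal_lineMap, affVal_row, affVal_row]
  rw [hres, hres]
  constructor
  · intro hp
    rw [hw.eq_of_proportional hp]
    nlinarith
  · intro hp
    have hwab := hw.2 a b hab hp
    by_cases hle : residual X y β b - residual X y β a ≤ residual X y w b - residual X y w a
    · nlinarith
    push Not at hle
    suffices h : s < (residual X y β b - residual X y β a) /
        ((residual X y β b - residual X y β a) - (residual X y w b - residual X y w a)) by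
      rw [lt_div_iff₀ (by linarith)] at h
      linarith
    have h1 : 1 < (residual X y β b - residual X y β a) /
        ((residual X y β b - residual X y β a) - (residual X y w b - residual X y w a)) := by
      rw [lt_div_iff₀ (by linarith)]; linarith
    have hneg : (residual X y β b - residual X y β a) /
        ((residual X y β b - residual X y β a) - (residual X y w b - residual X y w a)) =
        (residual X y β a - residual X y β b) /
        ((residual X y β a - residual X y β b) - (residual X y w a - residual X y w b)) := by
      rw [← neg_div_neg_eq]; congr 1 <;> ring
    rcases lt_trichotomy a b with hlt | rfl | hlt
    · rw [hneg] at h1 ⊢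
      exact hbound a b hlt (fun h => by linarith) h1
    · exact absurd hab (lt_irrefl _)
    · exact hbound b a hlt (fun h => by linarith) h1

end NextPoint

/-! ### The tightness test recognizes the facets -/

section Test

variable {n p : ℕ} {X : Fin n → Fin p → ℚ} {y : Fin n → ℚ}

theorem orderedPair_eq_or (a b : Fin n) : orderedPair a b = (a, b) ∨ orderedPair a b = (b, a) := by
  rcases le_total a b with h | h
  · left; simp [orderedPair, h]
  · right; simp [orderedPair, h]

theorem orderedPair_comm (a b : Fin n) : orderedPair a b = orderedPair b a := by
  simp [orderedPair, min_comm, max_comm]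

theorem orderedPair_of_lt {e : Fin n × Fin n} (he : e.1 < e.2) : orderedPair e.1 e.2 = e := by
  simp [orderedPair, he.le]

theorem orderedPair_lt {a b : Fin n} (h : a ≠ b) : (orderedPair a b).1 < (orderedPair a b).2 :=
  min_lt_max.2 h

theorem proportional_orderedPair (a b : Fin n) :
    Proportional (diffVec X y (orderedPair a b).1 (orderedPair a b).2) (diffVec X y a b) := by
  rcases orderedPair_eq_or a b with h | h <;> rw [h]
  · exact .refl _
  · exact diffVec_proportional_swap _ _

theorem eq_of_proportional_of_nonredundant (hd : DistinctRows X y) {e f : Fin n × Fin n}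
    (he : e.1 < e.2) (hf : f.1 < f.2) (heR : e ∉ redundantPairs X y)
    (hfR : f ∉ redundantPairs X y)
    (h : Proportional (diffVec X y e.1 e.2) (diffVec X y f.1 f.2)) : e = f := by
  rcases lt_trichotomy (toLex e) (toLex f) with hlt | heq | hlt
  · exact absurd ((mem_redundantPairs_iff hd).2 ⟨hf, e.1, e.2, he, h, hlt⟩) hfR
  · exact toLex.injective heq
  · exact absurd ((mem_redundantPairs_iff hd).2 ⟨he, f.1, f.2, hf, h.symm, hlt⟩) heR

/-- The nonredundant pair of a facet occupies two consecutive positions. -/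
theorem IsFacetPoint.exists_position (hd : DistinctRows X y) (ha : AdmissibleNumbering X y)
    {β w : Fin p → ℚ} {π : Fin n → Fin n} (hπ : SortedAt X y β π) {e : Fin n × Fin n}
    (he : e.1 < e.2) (heR : e ∉ redundantPairs X y) (hw : IsFacetPoint X y β e w) :
    ∃ (m : ℕ) (h : m + 1 < n), orderedPair (π ⟨m, by omega⟩) (π ⟨m + 1, h⟩) = e := by
  obtain ⟨i, hi⟩ := hπ.surjective e.1
  obtain ⟨j, hj⟩ := hπ.surjective e.2
  have key : ∀ i j : Fin n, i < j → (e = (π i, π j) ∨ e = (π j, π i)) → (j : ℕ) = i + 1 := by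
    intro i j hij hkl
    by_contra hne
    have h1 : (i : ℕ) < j := hij
    have h2 := j.2
    exact hw.not_between hd ha he heR (m := π ⟨i + 1, by omega⟩) hkl
      (hπ (Fin.lt_def.2 (by simp))) (hπ (Fin.lt_def.2 (by simp; omega)))
  have hne : i ≠ j := by rintro rfl; exact he.ne (hi.symm.trans hj)
  rcases lt_or_gt_of_ne hne with h | h
  · have hk := key i j h (Or.inl (by rw [hi, hj]))
    refine ⟨i, by have := j.2; omega, ?_⟩
    have : (⟨i + 1, by have := j.2; omega⟩ : Fin n) = j := Fin.ext hk.symm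
    rw [this, hj, Fin.eta, hi]
    exact orderedPair_of_lt he
  · have hk := key j i h (Or.inr (by rw [hi, hj]))
    refine ⟨j, by have := i.2; omega, ?_⟩
    have : (⟨j + 1, by have := i.2; omega⟩ : Fin n) = i := Fin.ext hk.symm
    rw [this, hi, Fin.eta, hj, orderedPair_comm]
    exact orderedPair_of_lt he

theorem IsFacetPoint.passesTest (hd : DistinctRows X y) {β w : Fin p → ℚ} {π : Fin n → Fin n}
    (hπ : SortedAt X y β π) {R : Finset (Fin n × Fin n)} (hR : (R : Set _) = redundantPairs X y)
    {e : Fin n × Fin n} (he : e.1 < e.2) (heR : e ∉ redundantPairs X y)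
    (hw : IsFacetPoint X y β e w) : PassesTest X y R π e w := by
  refine ⟨hw.1, fun m h hm => hw.2 _ _ (hπ (Fin.lt_def.2 (by simp))) fun hp => hm ?_⟩
  have hne : π ⟨m, by omega⟩ ≠ π ⟨m + 1, h⟩ := fun h' => by
    simpa using congrArg Fin.val (hπ.injective h')
  by_contra hmem
  rw [Finset.mem_insert, not_or] at hmem
  refine hmem.1 (eq_of_proportional_of_nonredundant hd he (orderedPair_lt hne) heR ?_
    (hp.trans (proportional_orderedPair _ _).symm)).symm
  rw [← hR]
  exact hmem.2

/-- Dropping the constraints of the redundant pairs does no harm. If a point passes the test, but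
some pair with another hyperplane is not in its strict order there, then a point nearby passes the
test, too, and has that pair in the reverse order. So a facet separates this point from the cell. Its
nonredundant pair is not `e`, and it is in consecutive positions, but then its constraint has been
kept, and it is violated. -/
theorem PassesTest.isFacetPoint (hd : DistinctRows X y) (ha : AdmissibleNumbering X y)
    {β w : Fin p → ℚ} {π : Fin n → Fin n} (hπ : SortedAt X y β π) {R : Finset (Fin n × Fin n)}
    (hR : (R : Set _) = redundantPairs X y) {e : Fin n × Fin n} (he : e.1 < e.2)
    (hw : PassesTest X y R π e w) : IsFacetPoint X y β e w := by
  refine ⟨hw.1, fun a b hab hnp => ?_⟩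
  by_contra hcon
  rw [not_lt] at hcon
  obtain ⟨z, hz, hzab⟩ : ∃ z, PassesTest X y R π e z ∧ residual X y z b < residual X y z a := by
    rcases hcon.lt_or_eq with hlt | heq
    · exact ⟨w, hw, hlt⟩
    have hv := diffVec_ne_zero hd he.ne
    have hv0 := residual_eq_iff.1 hw.1
    have hg0 : affVal (diffVec X y a b) w = 0 := residual_eq_iff.1 heq.symm
    obtain ⟨k₀, hk₀⟩ := exists_coeff_ne_zero hv hv0
    have hab' : a ≠ b := by rintro rfl; exact lt_irrefl _ hab
    obtain ⟨d, hd0, hd1⟩ : ∃ d : Fin p → ℚ, affVal (diffVec X y e.1 e.2) d = 0 ∧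
        0 < affVal (diffVec X y a b) d := by
      by_contra! hno
      refine hnp ?_
      obtain ⟨c, hc⟩ := exists_eq_smul_of_zeros_subset hk₀ (w := diffVec X y a b) fun d h0 => by
        refine le_antisymm (hno d h0) ?_
        -- reflect `d` in `w`
        have h1 := hno (d + (2 : ℚ) • (w - d)) (by rw [affVal_lineMap, h0, hv0]; ring)
        rw [affVal_lineMap, hg0] at h1
        linarith
      exact proportional_of_eq_smul (diffVec_ne_zero hd hab') hc
    have e1 : ∀ᶠ s : ℚ in 𝓝 0, ∀ q : Fin n × Fin n, residual X y w q.1 < residual X y w q.2 →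
        residual X y (w + s • (d - w)) q.1 < residual X y (w + s • (d - w)) q.2 := by
      refine Filter.eventually_all.2 fun q => ?_
      by_cases hq : residual X y w q.1 < residual X y w q.2
      · filter_upwards [(tendsto_affVal_lineMap _ w d).eventually
          (lt_mem_nhds (residual_lt_iff.1 hq))] with s hs _
        exact residual_lt_iff.2 hs
      · exact .of_forall fun s h => absurd h hq
    have e3 : ∀ᶠ s : ℚ in 𝓝[>] 0, 0 < s := eventually_mem_nhdsWithin
    obtain ⟨s, hs1, hs⟩ := ((e1.filter_mono nhdsWithin_le_nhds).and e3).exists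
    refine ⟨w + s • (d - w), ⟨?_, fun m h hm => hs1 (_, _) (hw.2 m h hm)⟩, ?_⟩
    · rw [residual_eq_iff, affVal_lineMap, hv0, hd0]; ring
    · rw [residual_lt_iff, affVal_lineMap, hg0, mul_zero, zero_add]
      exact mul_pos hs hd1
  obtain ⟨f, hf, hfR, hsep, w', hw'⟩ := exists_separating_facet hd hab hzab
  obtain ⟨m, h, hm⟩ := hw'.exists_position hd ha hπ hf hfR
  have hlt := hπ.residual_lt_iff.2 (show (⟨m, by omega⟩ : Fin n) < ⟨m + 1, h⟩ from
    Fin.lt_def.2 (by simp))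
  have hzlt := hz.2 m h (by
    rw [hm, Finset.mem_insert, not_or]
    constructor
    · rintro rfl
      have := hz.1
      rcases hsep with h1 | h1 <;> linarith [h1.2]
    · rw [← Finset.mem_coe, hR]; exact hfR)
  rcases orderedPair_eq_or (π ⟨m, by omega⟩) (π ⟨m + 1, h⟩) with h' | h' <;> rw [hm] at h' <;>
    rw [Separates, h'] at hsep <;> rcases hsep with h1 | h1 <;> linarith [h1.1, h1.2]

end Test

/-! ### The recursion -/

section Recursion

variable {n p : ℕ} {X : Fin n → Fin p → ℚ} {y : Fin n → ℚ} {S : LPSolver}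
  {R L : Finset (Fin n × Fin n)} {β : Fin p → ℚ} {π : Fin n → Fin n} {i : ℕ}

/-- The induction principle that follows the recursion of `rounds`: the list grows, or it stays and
the position advances. -/
theorem rounds_induction {P : (Fin p → ℚ) → Finset (Fin n × Fin n) → (Fin n → Fin n) → ℕ → Prop}
    (step : ∀ β L π i, (∀ e ∉ L, ∀ β' π' i', P β' (insert e L) π' i') →
      (i + 1 < n → P β L π (i + 1)) → P β L π i) (β L π i) : P β L π i := by
  induction hk : (Finset.univ \ L).card using Nat.strong_induction_on generalizing β L π i with
  | _ k ih =>
    have hL : ∀ e ∉ L, ∀ β' π' i', P β' (insert e L) π' i' := by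
      intro e he β' π' i'
      refine ih _ ?_ β' _ π' i' rfl
      rw [← hk]
      refine Finset.card_lt_card ⟨Finset.sdiff_subset_sdiff le_rfl (Finset.subset_insert e L),
        fun h => ?_⟩
      exact (Finset.mem_sdiff.1 (h (Finset.mem_sdiff.2 ⟨Finset.mem_univ e, he⟩))).2
        (Finset.mem_insert_self e L)
    induction hj : n - i generalizing i with
    | zero => exact step β L π i hL fun h => by omega
    | succ j ihj => exact step β L π i hL fun h => ihj (i + 1) (by omega)

theorem rounds_of_not_lt (hi : ¬ i + 1 < n) : rounds S X y R β L π i = tick [] := by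
  rw [rounds, dif_neg hi]

theorem rounds_of_mem (hi : i + 1 < n)
    (he : orderedPair (π ⟨i, by omega⟩) (π ⟨i + 1, hi⟩) ∈ R ∪ L) :
    rounds S X y R β L π i = (do steps 10 (); rounds S X y R β L π (i + 1)) := by
  rw [rounds, dif_pos hi]
  exact dif_neg (not_not.2 he)

theorem rounds_of_not_mem (hi : i + 1 < n) {e : Fin n × Fin n}
    (hdef : orderedPair (π ⟨i, by omega⟩) (π ⟨i + 1, hi⟩) = e) (he : e ∉ R ∪ L) :
    rounds S X y R β L π i = (do
      steps 10 ()
      let found ← tightnessTest S X y R π e.1 e.2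
      match found with
      | some βs => do
          let β₀ ← reserving p (nextPoint X y β βs)
          reserving 2 do
            steps 4 ()
            let L' := insert e L
            let out₁ ← visit X y β₀ fun π₀ => rounds S X y R β₀ L' π₀ 0
            let π' ← sortResiduals X y β
            let out₂ ← rounds S X y R β L' π' (i + 1)
            pure (out₁ ++ out₂)
      | none => rounds S X y R β L π (i + 1)) := by
  subst hdef
  rw [rounds, dif_pos hi]
  exact dif_pos he

/-- `z` and `β` lie on the same side of the hyperplanes of all the pairs in `L`. -/
def AgreeOn (X : Fin n → Fin p → ℚ) (y : Fin n → ℚ) (L : Finset (Fin n × Fin n))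
    (z β : Fin p → ℚ) : Prop :=
  ∀ e ∈ L, (residual X y z e.1 < residual X y z e.2 ↔ residual X y β e.1 < residual X y β e.2)

theorem visit_val (β : Fin p → ℚ) (rest : (Fin n → Fin n) → Cost (List (Fin n → Fin n))) :
    (visit X y β rest).val =
      (sortResiduals X y β).val :: (rest (sortResiduals X y β).val).val := rfl

theorem AgreeOn.not_separates {z : Fin p → ℚ} (h : AgreeOn X y L z β) {e : Fin n × Fin n}
    (he : e ∈ L) : ¬ Separates X y e β z := by
  have := h e he
  rintro (⟨h1, h2⟩ | ⟨h1, h2⟩)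
  · exact absurd (this.2 h1) h2.not_gt
  · exact absurd (this.1 h2) h1.not_gt

/-- A cell is determined by its side of the facets of the cell of `β`: if all of these are in `L`,
then no other cell agrees with the cell of `β` on `L`. -/
theorem eq_of_agreeOn_facets (hd : DistinctRows X y) (ha : AdmissibleNumbering X y)
    (hπ : SortedAt X y β π)
    (hL : ∀ e : Fin n × Fin n, e.1 < e.2 → e ∉ redundantPairs X y →
      (∃ (m : ℕ) (h : m + 1 < n), orderedPair (π ⟨m, by omega⟩) (π ⟨m + 1, h⟩) = e) →
      (∃ w, IsFacetPoint X y β e w) → e ∈ L)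
    {z : Fin p → ℚ} {f : Fin n → Fin n} (hf : SortedAt X y z f) (hz : AgreeOn X y L z β) :
    f = π := by
  refine hf.unique (hπ.congr fun a b hab => ?_)
  by_contra hcon
  have hab' : a ≠ b := by rintro rfl; exact lt_irrefl _ hab
  have hlt : residual X y z b < residual X y z a :=
    lt_of_le_of_ne (not_lt.1 hcon) fun h => hab' (hf.residual_injective h).symm
  obtain ⟨e, he, heR, hsep, w, hw⟩ := exists_separating_facet hd hab hlt
  exact hz.not_separates (hL e he heR (hw.exists_position hd ha hπ he heR) ⟨w, hw⟩) hsep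

/-- The rounds from position `i` on output, without repetition, the cells other than the current one
that lie on the same side of the hyperplanes in `L` as the current cell, provided that the facets
at earlier positions are in `L`. -/
theorem rounds_spec (S : LPSolver) (hd : DistinctRows X y) (ha : AdmissibleNumbering X y)
    (hR : (R : Set _) = redundantPairs X y) (β : Fin p → ℚ) (L : Finset (Fin n × Fin n))
    (π : Fin n → Fin n) (i : ℕ) (hπ : SortedAt X y β π)
    (hL : ∀ e ∈ L, e.1 < e.2 ∧ e ∉ redundantPairs X y)
    (hi : ∀ (m : ℕ) (h : m + 1 < n), m < i →
      orderedPair (π ⟨m, by omega⟩) (π ⟨m + 1, h⟩) ∉ redundantPairs X y →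
      (∃ w, IsFacetPoint X y β (orderedPair (π ⟨m, by omega⟩) (π ⟨m + 1, h⟩)) w) →
      orderedPair (π ⟨m, by omega⟩) (π ⟨m + 1, h⟩) ∈ L) :
    (rounds S X y R β L π i).val.Nodup ∧
      ∀ f, f ∈ (rounds S X y R β L π i).val ↔
        f ≠ π ∧ ∃ z, SortedAt X y z f ∧ AgreeOn X y L z β := by
  induction β, L, π, i using rounds_induction with
  | step β L π i ih₁ ih₂ =>
  have hRmem : ∀ e, e ∈ R ↔ e ∈ redundantPairs X y := fun e => by rw [← hR, Finset.mem_coe]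
  by_cases hin : i + 1 < n
  swap
  · rw [rounds_of_not_lt hin]
    refine ⟨List.nodup_nil, fun f => ⟨fun h => by simp at h, ?_⟩⟩
    rintro ⟨hne, z, hf, hz⟩
    refine absurd (eq_of_agreeOn_facets hd ha hπ (L := L) ?_ hf hz) hne
    rintro e he heR ⟨m, h, rfl⟩ hw
    exact hi m h (by omega) heR hw
  -- extending the invariant to the position `i`
  have hstep : ∀ L', L ⊆ L' →
      (orderedPair (π ⟨i, by omega⟩) (π ⟨i + 1, hin⟩) ∉ redundantPairs X y →
        (∃ w, IsFacetPoint X y β (orderedPair (π ⟨i, by omega⟩) (π ⟨i + 1, hin⟩)) w) →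
        orderedPair (π ⟨i, by omega⟩) (π ⟨i + 1, hin⟩) ∈ L') →
      ∀ (m : ℕ) (h : m + 1 < n), m < i + 1 →
        orderedPair (π ⟨m, by omega⟩) (π ⟨m + 1, h⟩) ∉ redundantPairs X y →
        (∃ w, IsFacetPoint X y β (orderedPair (π ⟨m, by omega⟩) (π ⟨m + 1, h⟩)) w) →
        orderedPair (π ⟨m, by omega⟩) (π ⟨m + 1, h⟩) ∈ L' := by
    intro L' hLL' hnew m h hm heR hw
    rcases Nat.lt_succ_iff_lt_or_eq.1 hm with hm | rfl
    · exact hLL' (hi m h hm heR hw)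
    · exact hnew heR hw
  have hne : π ⟨i, by omega⟩ ≠ π ⟨i + 1, hin⟩ := fun h' => by
    simpa using congrArg Fin.val (hπ.injective h')
  have hlt := orderedPair_lt hne
  generalize he_def : orderedPair (π ⟨i, by omega⟩) (π ⟨i + 1, hin⟩) = e at hstep hlt
  by_cases he : e ∈ R ∪ L
  · rw [rounds_of_mem hin (by rw [he_def]; exact he)]
    simp only [bind_val]
    refine ih₂ hin hπ hL (hstep L subset_rfl fun heR _ => ?_)
    rcases Finset.mem_union.1 he with h | h
    · exact absurd ((hRmem e).1 h) heR
    · exact h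
  rw [rounds_of_not_mem hin he_def he]
  have heL : e ∉ L := fun h => he (Finset.mem_union_right _ h)
  have heR : e ∉ redundantPairs X y := fun h => he (Finset.mem_union_left _ ((hRmem e).2 h))
  simp only [bind_val]
  cases htest : (tightnessTest S X y R π e.1 e.2).val with
  | none =>
    refine ih₂ hin hπ hL (hstep L subset_rfl fun _ ⟨w, hw⟩ => ?_)
    exact absurd (hw.passesTest hd hπ hR hlt heR) (not_passesTest_of_tightnessTest htest w)
  | some w =>
    have hw : IsFacetPoint X y β e w :=
      (passesTest_of_tightnessTest htest).isFacetPoint hd ha hπ hR hlt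
    simp only [bind_val, reserving_val, visit_val, pure_val]
    set β₀ := (nextPoint X y β w).val with hβ₀
    have hβ : Function.Injective (residual X y β) := hπ.residual_injective
    have hord : ∀ {a b : Fin n}, residual X y β a < residual X y β b →
        (Proportional (diffVec X y e.1 e.2) (diffVec X y a b) →
          residual X y β₀ b < residual X y β₀ a) ∧
        (¬ Proportional (diffVec X y e.1 e.2) (diffVec X y a b) →
          residual X y β₀ a < residual X y β₀ b) := fun hab => nextPoint_order hw hab
    have hβ₀inj : Function.Injective (residual X y β₀) := by
      intro a b hab
      by_contra hne
      have hboth : ∀ a b : Fin n, residual X y β a < residual X y β b →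
          residual X y β₀ a ≠ residual X y β₀ b := fun a b hlt heq => by
        by_cases hp : Proportional (diffVec X y e.1 e.2) (diffVec X y a b)
        · exact ((hord hlt).1 hp).ne heq.symm
        · exact ((hord hlt).2 hp).ne heq
      rcases lt_or_gt_of_ne fun h => hne (hβ h) with h | h
      · exact hboth a b h hab
      · exact hboth b a h hab.symm
    have hπ₀ := sortResiduals_sortedAt hβ₀inj
    set π₀ := (sortResiduals X y β₀).val with hπ₀def
    have hπ' : (sortResiduals X y β).val = π := (sortResiduals_sortedAt hβ).unique hπ
    rw [hπ']
    have hL' : ∀ f ∈ insert e L, f.1 < f.2 ∧ f ∉ redundantPairs X y := by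
      intro f hf
      rcases Finset.mem_insert.1 hf with rfl | hf
      · exact ⟨hlt, heR⟩
      · exact hL f hf
    obtain ⟨nd₁, mem₁⟩ := ih₁ e heL β₀ π₀ 0 hπ₀ hL' (by simp)
    obtain ⟨nd₂, mem₂⟩ := ih₁ e heL β π (i + 1) hπ hL'
      (hstep _ (Finset.subset_insert e L) fun _ _ => Finset.mem_insert_self e L)
    -- the point `β₀` is on the same side as `β` for the pairs in `L`, on the other one for `e`
    have hside : ∀ f ∈ L, (residual X y β₀ f.1 < residual X y β₀ f.2 ↔
        residual X y β f.1 < residual X y β f.2) := by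
      intro f hf
      have hnp : ¬ Proportional (diffVec X y e.1 e.2) (diffVec X y f.1 f.2) := fun hp =>
        heL (by rwa [eq_of_proportional_of_nonredundant hd hlt (hL f hf).1 heR (hL f hf).2 hp])
      rcases lt_or_gt_of_ne fun h => (hL f hf).1.ne (hβ h) with h | h
      · exact iff_of_true ((hord h).2 hnp) h
      · exact iff_of_false
          ((hord h).2 fun hp => hnp (hp.trans (diffVec_proportional_swap _ _))).not_gt h.not_gt
    have hside' : residual X y β₀ e.1 < residual X y β₀ e.2 ↔
        ¬ residual X y β e.1 < residual X y β e.2 := by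
      rcases lt_or_gt_of_ne fun h => hlt.ne (hβ h) with h | h
      · exact iff_of_false ((hord h).1 (.refl _)).not_gt (not_not.2 h)
      · exact iff_of_true ((hord h).1 (diffVec_proportional_swap _ _)) h.not_gt
    have hagree₁ : ∀ z, AgreeOn X y (insert e L) z β₀ ↔ AgreeOn X y L z β ∧
        (residual X y z e.1 < residual X y z e.2 ↔ ¬ residual X y β e.1 < residual X y β e.2) := by
      intro z
      simp only [AgreeOn, Finset.forall_mem_insert, hside']
      rw [and_comm]
      exact and_congr_left' (forall₂_congr fun f hf => by rw [hside f hf])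
    have hagree₂ : ∀ z, AgreeOn X y (insert e L) z β ↔ AgreeOn X y L z β ∧
        (residual X y z e.1 < residual X y z e.2 ↔ residual X y β e.1 < residual X y β e.2) := by
      intro z
      simp only [AgreeOn, Finset.forall_mem_insert]
      rw [and_comm]
    have memc : ∀ f, f ∈ π₀ :: (rounds S X y R β₀ (insert e L) π₀ 0).val ↔
        ∃ z, SortedAt X y z f ∧ AgreeOn X y (insert e L) z β₀ := by
      intro f
      rw [List.mem_cons, mem₁]
      constructor
      · rintro (rfl | h)
        · exact ⟨β₀, hπ₀, fun _ _ => Iff.rfl⟩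
        · exact h.2
      · exact fun h => or_iff_not_imp_left.2 fun h' => ⟨h', h⟩
    constructor
    · refine List.Nodup.append (List.nodup_cons.2 ⟨fun h => ((mem₁ _).1 h).1 rfl, nd₁⟩) nd₂ ?_
      intro f h₁ h₂
      obtain ⟨z, hz, hza⟩ := (memc f).1 h₁
      obtain ⟨-, z', hz', hza'⟩ := (mem₂ f).1 h₂
      have h1 := ((hagree₁ z).1 hza).2
      have h2 := ((hagree₂ z').1 hza').2
      rw [hz.lt_iff_lt hz'] at h1
      tauto
    · intro f
      rw [List.mem_append, memc, mem₂]
      constructor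
      · rintro (⟨z, hz, hza⟩ | ⟨hf, z, hz, hza⟩)
        · have h1 := (hagree₁ z).1 hza
          refine ⟨?_, z, hz, h1.1⟩
          rintro rfl
          have h2 := h1.2
          rw [hz.lt_iff_lt hπ] at h2
          tauto
        · exact ⟨hf, z, hz, ((hagree₂ z).1 hza).1⟩
      · rintro ⟨hf, z, hz, hza⟩
        by_cases hs : residual X y z e.1 < residual X y z e.2 ↔
            residual X y β e.1 < residual X y β e.2
        · exact Or.inr ⟨hf, z, hz, (hagree₂ z).2 ⟨hza, hs⟩⟩
        · exact Or.inl ⟨z, hz, (hagree₁ z).2 ⟨hza, by tauto⟩⟩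

end Recursion

/-! ### The list of redundant pairs -/

section Redundant

variable {n p d : ℕ} {X : Fin n → Fin p → ℚ} {y : Fin n → ℚ}

/-- The first nonzero one among the entries of `v` with indices in `l`, if `s = 0`; else `s`. -/
def firstNonzero (v : Fin d → ℚ) (l : List (Fin d)) (s : ℚ) : ℚ :=
  l.foldl (fun s k => if s = 0 then v k else s) s

theorem firstNonzero_eq_zero_iff (v : Fin d → ℚ) (l : List (Fin d)) (s : ℚ) :
    firstNonzero v l s = 0 ↔ s = 0 ∧ ∀ k ∈ l, v k = 0 := by
  induction l generalizing s with
  | nil => simp [firstNonzero]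
  | cons i l ih =>
    have h := ih (if s = 0 then v i else s)
    rw [show firstNonzero v (i :: l) s = firstNonzero v l (if s = 0 then v i else s) from rfl, h]
    split_ifs with hs <;> simp [hs]

theorem firstNonzero_smul {c : ℚ} (hc : c ≠ 0) (v : Fin d → ℚ) (l : List (Fin d)) (s : ℚ) :
    firstNonzero (c • v) l (c * s) = c * firstNonzero v l s := by
  induction l generalizing s with
  | nil => rfl
  | cons i l ih =>
    have h := ih (if s = 0 then v i else s)
    rw [show firstNonzero v (i :: l) s = firstNonzero v l (if s = 0 then v i else s) from rfl, ← h]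
    simp only [firstNonzero, List.foldl_cons]
    congr 1
    by_cases hs : s = 0 <;> simp [hs, hc]

theorem normalForm_val (i j : Fin n) :
    (normalForm X y i j).val = fun k => diffVec X y i j k /
      firstNonzero (diffVec X y i j) (List.finRange (p + 1)) 0 := by
  funext k
  simp only [normalForm, bind_val, loop_val, tabulate_val, tick_val]
  rfl

theorem normalForm_eq_iff (hd : DistinctRows X y) {i j k l : Fin n} (hij : i ≠ j) (hkl : k ≠ l) :
    (normalForm X y i j).val = (normalForm X y k l).val ↔
      Proportional (diffVec X y i j) (diffVec X y k l) := by
  have hv := diffVec_ne_zero hd hij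
  have hw := diffVec_ne_zero hd hkl
  rw [normalForm_val, normalForm_val]
  generalize diffVec X y i j = v at *
  generalize diffVec X y k l = w at *
  have hne : ∀ u : Fin (p + 1) → ℚ, u ≠ 0 → firstNonzero u (List.finRange (p + 1)) 0 ≠ 0 := by
    intro u hu h
    exact hu (funext fun k => ((firstNonzero_eq_zero_iff _ _ _).1 h).2 k (List.mem_finRange k))
  constructor
  · intro h
    refine proportional_of_eq_smul (c := firstNonzero w (List.finRange (p + 1)) 0 /
      firstNonzero v (List.finRange (p + 1)) 0) hw (funext fun k => ?_)
    have hk := congrFun h k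
    have h1 := hne v hv
    have h2 := hne w hw
    simp only [Pi.smul_apply, smul_eq_mul]
    field_simp at hk ⊢
    linarith
  · rintro ⟨c, hc, rfl⟩
    funext k
    have := firstNonzero_smul hc v (List.finRange (p + 1)) 0
    rw [mul_zero] at this
    rw [this, Pi.smul_apply, smul_eq_mul, mul_div_mul_left _ _ hc]

theorem foldl_then (u v : Fin d → ℚ) (l : List (Fin d)) (o : Ordering) :
    l.foldl (fun o k => o.then (compare (u k) (v k))) o =
      o.then (l.foldl (fun o k => o.then (compare (u k) (v k))) Ordering.eq) := by
  induction l generalizing o with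
  | nil => cases o <;> rfl
  | cons i l ih =>
    rw [List.foldl_cons, List.foldl_cons, ih, ih (Ordering.eq.then _)]
    cases o <;> rfl

/-- The loop of `compareVectors` computes the lexicographic comparison of the lists of entries. -/
theorem foldl_then_compares (u v : Fin d → ℚ) (l : List (Fin d)) :
    (l.foldl (fun o k => o.then (compare (u k) (v k))) Ordering.eq).Compares
      (l.map u) (l.map v) := by
  induction l with
  | nil => rfl
  | cons i l ih =>
    rw [List.foldl_cons, foldl_then, List.map_cons, List.map_cons]
    rcases lt_trichotomy (u i) (v i) with h | h | h
    · rw [compare_lt_iff_lt.2 h]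
      exact List.cons_lt_cons_iff.2 (Or.inl h)
    · rw [compare_eq_iff_eq.2 h, h]
      generalize List.foldl _ _ l = o at ih
      cases o
      · exact List.cons_lt_cons_iff.2 (Or.inr ⟨rfl, ih⟩)
      · exact congrArg _ ih
      · exact List.cons_lt_cons_iff.2 (Or.inr ⟨rfl, ih⟩)
    · rw [compare_gt_iff_gt.2 h]
      exact List.cons_lt_cons_iff.2 (Or.inl h)

theorem compareVectors_compares (u v : Fin d → ℚ) :
    (compareVectors u v).val.Compares ((List.finRange d).map u) ((List.finRange d).map v) := by
  have h := foldl_then_compares u v (List.finRange d)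
  rw [compareVectors, loop_val]
  exact h

/-- The sort key of an entry of the table: the normal form, compared lexicographically, and then
the pair. -/
def sortKey (u : (Fin d → ℚ) × (Fin n × Fin n)) : List ℚ ×ₗ (Fin n ×ₗ Fin n) :=
  toLex ((List.finRange d).map u.1, toLex u.2)

theorem map_finRange_injective :
    Function.Injective fun u : Fin d → ℚ => (List.finRange d).map u := by
  intro u v h
  funext k
  exact List.map_inj_left.1 h k (List.mem_finRange k)

theorem sortKey_injective : Function.Injective (sortKey (n := n) (d := d)) := by
  intro u v h
  have h' := Prod.ext_iff.1 (toLex.injective h)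
  exact Prod.ext (map_finRange_injective h'.1) (toLex.injective h'.2)

theorem sortKey_lt_iff (u v : (Fin d → ℚ) × (Fin n × Fin n)) :
    sortKey u < sortKey v ↔ (List.finRange d).map u.1 < (List.finRange d).map v.1 ∨
      u.1 = v.1 ∧ toLex u.2 < toLex v.2 := by
  rw [sortKey, sortKey, Prod.Lex.toLex_lt_toLex, map_finRange_injective.eq_iff]

theorem isLE_then_iff (u v : (Fin d → ℚ) × (Fin n × Fin n)) :
    ((compareVectors u.1 v.1).val.then
      ((compare u.2.1 v.2.1).then (compare u.2.2 v.2.2))).isLE = true ↔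
      sortKey u ≤ sortKey v := by
  have hc := compareVectors_compares u.1 v.1
  rw [sortKey, sortKey, Prod.Lex.toLex_le_toLex, Prod.Lex.toLex_le_toLex]
  generalize (compareVectors u.1 v.1).val = o at hc
  simp only
  cases o with
  | lt => exact iff_of_true rfl (Or.inl hc)
  | eq =>
    have hc' : (List.finRange d).map u.1 = (List.finRange d).map v.1 := hc
    simp only [hc', lt_self_iff_false, false_or, true_and]
    rcases lt_trichotomy u.2.1 v.2.1 with h' | h' | h'
    · rw [compare_lt_iff_lt.2 h']; simp [h']
    · rw [compare_eq_iff_eq.2 h']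
      rw [← compare_le_iff_le (a := u.2.2)]
      simp only [h', lt_self_iff_false, false_or, true_and]
      cases compare u.2.2 v.2.2 <;> simp [Ordering.then]
    · rw [compare_gt_iff_gt.2 h']; simp [h'.not_gt, h'.ne']
  | gt =>
    have hc' : (List.finRange d).map v.1 < (List.finRange d).map u.1 := hc
    simp [hc'.not_gt, hc'.ne']

/-- In the sorted list, the entries with the same normal form are consecutive and ordered by their
pairs; so exactly the smallest pair of each group is not marked. -/
theorem mem_markRepeated_iff (l : List ((Fin d → ℚ) × (Fin n × Fin n)))
    (hl : l.Pairwise fun u v => sortKey u < sortKey v) (e : Fin n × Fin n) :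
    e ∈ (markRepeated l).val ↔
      ∃ v ∈ l, v.2 = e ∧ ∃ u ∈ l, u.1 = v.1 ∧ toLex u.2 < toLex v.2 := by
  have hlt : ∀ u v : (Fin d → ℚ) × (Fin n × Fin n), u.1 = v.1 →
      (sortKey u < sortKey v ↔ toLex u.2 < toLex v.2) := fun u v h => by
    rw [sortKey_lt_iff, h]; simp
  fun_induction markRepeated l with
  | case1 u v l ih =>
    have hl' := (List.pairwise_cons.1 hl).2
    have hu := (List.pairwise_cons.1 hl).1
    have huv := hu v List.mem_cons_self
    have ih' := ih hl'
    simp only [bind_val, tick_val]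
    have heq : (compareVectors u.1 v.1).val = Ordering.eq ↔ u.1 = v.1 := by
      rw [(compareVectors_compares u.1 v.1).eq_eq, map_finRange_injective.eq_iff]
    have hmem : e ∈ (if (compareVectors u.1 v.1).val = Ordering.eq then
        insert v.2 (markRepeated (v :: l)).val else (markRepeated (v :: l)).val) ↔
        (u.1 = v.1 ∧ e = v.2) ∨ e ∈ (markRepeated (v :: l)).val := by
      by_cases h : u.1 = v.1
      · rw [if_pos (heq.2 h)]; simp [h]
      · rw [if_neg fun h' => h (heq.1 h')]; simp [h]
    refine hmem.trans ((or_congr_right ih').trans ?_)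
    constructor
    · rintro (⟨h, rfl⟩ | ⟨w, hw, hwe, w', hw', h⟩)
      · exact ⟨v, by simp, rfl, u, by simp, h, (hlt u v h).1 huv⟩
      · exact ⟨w, List.mem_cons_of_mem _ hw, hwe, w', List.mem_cons_of_mem _ hw', h⟩
    · rintro ⟨w, hw, rfl, w', hw', h1, h2⟩
      have hkey := (hlt w' w h1).2 h2
      rcases List.mem_cons.1 hw with hwu | hwt
      · subst hwu
        rcases List.mem_cons.1 hw' with hwu' | hwt'
        · subst hwu'
          exact absurd hkey (lt_irrefl _)
        · exact absurd (hu w' hwt') hkey.not_gt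
      rcases List.mem_cons.1 hw' with hwu' | hwt'
      · rw [hwu'] at h1 h2
        rcases List.mem_cons.1 hwt with hwv | hwl
        · rw [hwv] at h1 ⊢
          exact Or.inl ⟨h1, rfl⟩
        · -- `v` lies between `u` and `w` in the sorted list, and so has the same normal form
          have hvw := (List.pairwise_cons.1 hl').1 w hwl
          have hvw1 : v.1 = w.1 := by
            rcases (sortKey_lt_iff _ _).1 hvw with h | h
            · rcases (sortKey_lt_iff _ _).1 huv with h' | h'
              · rw [h1] at h'
                exact absurd h h'.not_gt
              · exact h'.1.symm.trans h1
            · exact h.1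
          exact Or.inr ⟨w, hwt, rfl, v, by simp, hvw1, (hlt v w hvw1).1 hvw⟩
      · exact Or.inr ⟨w, hwt, rfl, w', hwt', h1, h2⟩
  | case2 l h =>
    match l, h with
    | [], _ => simp
    | [u], _ => simp
    | u :: v :: l, h => exact absurd rfl (h u v l)

/-- The unsorted table of normal forms in `constructR`. -/
def hyperplaneTable (X : Fin n → Fin p → ℚ) (y : Fin n → ℚ) :
    List ((Fin (p + 1) → ℚ) × (Fin n × Fin n)) :=
  ((allPairs n).filterMap fun e =>
    if e.1 < e.2 then some ((normalForm X y e.1 e.2).val, e) else none).reverse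

/-- The comparison of the sorting step in `constructR`. -/
def compareEntries (u v : (Fin d → ℚ) × (Fin n × Fin n)) : Cost Bool := do
  let o ← compareVectors u.1 v.1
  steps 3 ((o.then ((compare u.2.1 v.2.1).then (compare u.2.2 v.2.2))).isLE)

/-- The loop of `constructR` that fills the table. -/
def tableLoop (X : Fin n → Fin p → ℚ) (y : Fin n → ℚ) :
    Cost (List ((Fin (p + 1) → ℚ) × (Fin n × Fin n))) :=
  loop (fun t e =>
      if e.1 < e.2 then do
        let v ← normalForm X y e.1 e.2
        steps 3 ((v, e) :: t)
      else pure t)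
    (allPairs n) []

theorem tableLoop_val : (tableLoop X y).val = hyperplaneTable X y := by
  have h := foldl_cons_eq_filterMap (fun e : Fin n × Fin n =>
    if e.1 < e.2 then some ((normalForm X y e.1 e.2).val, e) else none) (allPairs n) []
  rw [List.append_nil] at h
  rw [hyperplaneTable, ← h, tableLoop, loop_val]
  congr 1
  funext s e
  split_ifs <;> rfl

theorem constructR_eq : constructR X y = reserving (n * n * (p + 4)) (do
    let table ← tableLoop X y
    let sorted ← mergeSort compareEntries table
    markRepeated sorted) := rfl

theorem mem_hyperplaneTable_iff (u : (Fin (p + 1) → ℚ) × (Fin n × Fin n)) :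
    u ∈ hyperplaneTable X y ↔ u.2.1 < u.2.2 ∧ u.1 = (normalForm X y u.2.1 u.2.2).val := by
  rw [hyperplaneTable, List.mem_reverse, List.mem_filterMap]
  constructor
  · rintro ⟨e, -, h⟩
    split_ifs at h with he
    rw [← Option.some.inj h]
    exact ⟨he, rfl⟩
  · rintro ⟨h1, h2⟩
    refine ⟨u.2, mem_allPairs _, ?_⟩
    rw [if_pos h1, ← h2]

theorem hyperplaneTable_nodup : (hyperplaneTable X y).Nodup := by
  rw [hyperplaneTable, List.nodup_reverse]
  refine List.Nodup.filterMap ?_ ((List.nodup_finRange n).product (List.nodup_finRange n))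
  intro e f u he hf
  simp only [Option.mem_def] at he hf
  split_ifs at he hf
  rw [← Option.some.inj he] at hf
  exact (Prod.ext_iff.1 (Option.some.inj hf)).2.symm

theorem constructR_val (hd : DistinctRows X y) :
    ((constructR X y).val : Set (Fin n × Fin n)) = redundantPairs X y := by
  have hperm := mergeSort_perm compareEntries (hyperplaneTable X y)
  have hsorted : (mergeSort compareEntries (hyperplaneTable X y)).val.Pairwise
      fun u v => sortKey u < sortKey v := by
    refine List.Pairwise.imp₂ (R := fun u v => sortKey u ≤ sortKey v) (S := fun u v => u ≠ v)
      (fun u v h h' => lt_of_le_of_ne h fun h'' => h' (sortKey_injective h''))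
      (mergeSort_pairwise (fun u v => isLE_then_iff u v) _)
      (hperm.nodup_iff.2 hyperplaneTable_nodup)
  ext e
  rw [Finset.mem_coe, constructR_eq]
  simp only [reserving_val, bind_val, tableLoop_val]
  rw [mem_markRepeated_iff _ hsorted, mem_redundantPairs_iff hd]
  simp only [hperm.mem_iff, mem_hyperplaneTable_iff]
  constructor
  · rintro ⟨v, ⟨hv, hv'⟩, rfl, u, ⟨hu, hu'⟩, h, hlt⟩
    refine ⟨hv, u.2.1, u.2.2, hu, ?_, hlt⟩
    rw [← normalForm_eq_iff hd hu.ne hv.ne, ← hu', ← hv', h]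
  · rintro ⟨he, i, j, hij, hp, hlt⟩
    refine ⟨((normalForm X y e.1 e.2).val, e), ⟨he, rfl⟩, rfl,
      ((normalForm X y i j).val, (i, j)), ⟨hij, rfl⟩, ?_, hlt⟩
    exact (normalForm_eq_iff hd hij.ne he.ne).2 hp

end Redundant

/-! ### Cells and their interior points -/

section Cells

variable {n p : ℕ} {X : Fin n → Fin p → ℚ} {y : Fin n → ℚ}

theorem continuous_affVal (v : Fin (p + 1) → ℚ) :
    Continuous fun β : Fin p → ℝ => affVal v β := by
  unfold affVal
  fun_prop

/-- In the interior of a cell the residuals are distinct: an affine function that is nonnegative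
near a zero is constant. -/
theorem residual_lt_of_mem_interior (hd : DistinctRows X y) {π : Equiv.Perm (Fin n)}
    {β : Fin p → ℝ} (hβ : β ∈ interior (region X y π)) {i j : Fin n} (hij : i < j) :
    residual X y β (π i) < residual X y β (π j) := by
  refine lt_of_le_of_ne (interior_subset hβ i j hij.le) fun heq => ?_
  obtain ⟨d, hd'⟩ := exists_affVal_ne_zero (K := ℝ)
    (diffVec_ne_zero hd (fun h => hij.ne' (π.injective h) : π j ≠ π i))
  have h0 : affVal (diffVec X y (π j) (π i)) β = 0 := by rw [affVal_diffVec, heq, sub_self]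
  have hev : ∀ᶠ s : ℝ in 𝓝 0, β + s • (d - β) ∈ interior (region X y π) := by
    have : ContinuousAt (fun s : ℝ => β + s • (d - β)) 0 := by fun_prop
    refine this.eventually ?_
    simpa using isOpen_interior.mem_nhds hβ
  have hneg : ∀ᶠ s : ℝ in 𝓝 0, β + (-s) • (d - β) ∈ interior (region X y π) := by
    have : Tendsto (fun s : ℝ => -s) (𝓝 0) (𝓝 0) := by
      simpa using (continuous_neg (G := ℝ)).tendsto 0
    exact this.eventually hev
  have hpos : ∀ᶠ s : ℝ in 𝓝[>] 0, 0 < s := eventually_mem_nhdsWithin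
  obtain ⟨s, ⟨h1, h2⟩, hs⟩ :=
    (((hev.and hneg).filter_mono nhdsWithin_le_nhds).and hpos).exists
  have key : ∀ s : ℝ, β + s • (d - β) ∈ interior (region X y π) →
      0 ≤ s * affVal (diffVec X y (π j) (π i)) d := fun s h => by
    have h' := interior_subset h i j hij.le
    rw [← sub_nonneg, ← affVal_diffVec, affVal_lineMap, h0] at h'
    linarith
  have k1 := key s h1
  have k2 := key (-s) h2
  have : s * affVal (diffVec X y (π j) (π i)) d = 0 := le_antisymm (by linarith) k1
  rcases mul_eq_zero.1 this with h | h
  · exact hs.ne' h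
  · exact hd' h

theorem isOpen_strictRegion (π : Equiv.Perm (Fin n)) :
    IsOpen {β : Fin p → ℝ | ∀ i j, i < j → residual X y β (π i) < residual X y β (π j)} := by
  simp only [Set.ofPred_forall]
  refine isOpen_iInter_of_finite fun i => isOpen_iInter_of_finite fun j =>
    isOpen_iInter_of_finite fun _ => ?_
  simp only [← affVal_row]
  exact isOpen_lt (continuous_affVal _) (continuous_affVal _)

/-- The rational points in the interior of `C^π` are those where `π` sorts the residuals. -/
theorem sortedAt_iff_mem_interior (hd : DistinctRows X y) {π : Equiv.Perm (Fin n)}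
    {z : Fin p → ℚ} :
    SortedAt X y z π ↔ (fun k => (z k : ℝ)) ∈ interior (region X y π) := by
  constructor
  · intro h
    refine mem_interior.2 ⟨_, fun β hβ i j hij => ?_, isOpen_strictRegion (X := X) (y := y) π,
      fun i j hij => ?_⟩
    · rcases hij.eq_or_lt with rfl | hij
      · exact le_rfl
      · exact (hβ i j hij).le
    · rw [residual_ratCast, residual_ratCast]
      exact_mod_cast h hij
  · intro h i j hij
    have := residual_lt_of_mem_interior hd h hij
    rw [residual_ratCast, residual_ratCast] at this
    exact_mod_cast this

theorem denseRange_ratCast : DenseRange fun (z : Fin p → ℚ) (k : Fin p) => (z k : ℝ) :=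
  DenseRange.piMap (ι := Fin p) fun _ => Rat.denseRange_cast

theorem exists_mem_cells_iff (hd : DistinctRows X y) (f : Fin n → Fin n) :
    (∃ π ∈ cells X y, f = ⇑π) ↔ ∃ z, SortedAt X y z f := by
  constructor
  · rintro ⟨π, hπ, rfl⟩
    obtain ⟨z, hz⟩ := denseRange_ratCast.exists_mem_open isOpen_interior hπ
    exact ⟨z, (sortedAt_iff_mem_interior hd).2 hz⟩
  · rintro ⟨z, hz⟩
    let π : Equiv.Perm (Fin n) := Equiv.ofBijective f ⟨hz.injective, hz.surjective⟩
    have hπ : f = ⇑π := rfl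
    exact ⟨π, ⟨_, (sortedAt_iff_mem_interior hd).1 (hπ ▸ hz)⟩, hπ⟩

theorem rsIncEnu_spec (S : LPSolver) (hd : DistinctRows X y) (ha : AdmissibleNumbering X y)
    {β : Fin p → ℚ} (hβ : Function.Injective (residual X y β)) :
    (rsIncEnu S X y β).val.Nodup ∧
      ∀ f, f ∈ (rsIncEnu S X y β).val ↔ ∃ z, SortedAt X y z f := by
  have hπ := sortResiduals_sortedAt hβ
  obtain ⟨h1, h2⟩ := rounds_spec S hd ha (constructR_val hd) β ∅ _ 0 hπ (by simp) (by simp)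
  simp only [rsIncEnu, reserving_val, bind_val, visit_val]
  refine ⟨List.nodup_cons.2 ⟨fun h => ((h2 _).1 h).1 rfl, h1⟩, fun f => ?_⟩
  rw [List.mem_cons, h2]
  constructor
  · rintro (rfl | ⟨-, z, hz, -⟩)
    · exact ⟨β, hπ⟩
    · exact ⟨z, hz⟩
  · rintro ⟨z, hz⟩
    exact or_iff_not_imp_left.2 fun h => ⟨h, z, hz, by simp [AgreeOn]⟩

theorem length_eq_ncard_cells {l : List (Fin n → Fin n)} (hl : l.Nodup)
    (h : ∀ f, f ∈ l ↔ ∃ π ∈ cells X y, f = ⇑π) : l.length = (cells X y).ncard := by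
  have h1 : (l.toFinset : Set (Fin n → Fin n)) =
      (fun π : Equiv.Perm (Fin n) => ⇑π) '' cells X y := by
    ext f
    simp only [Finset.mem_coe, List.mem_toFinset, h, Set.mem_image, eq_comm]
  rw [← List.toFinset_card_of_nodup hl, ← Set.ncard_coe_finset, h1,
    Set.ncard_image_of_injective _ DFunLike.coe_injective]

end Cells

/-! ### Admissible numberings -/

/-- Numbering the rows by increasing `‖x_i‖²` is admissible: on a segment, a strictly convex
function is largest at one of the end points only. -/
theorem exists_admissibleNumbering {n p : ℕ} (X : Fin n → Fin p → ℚ) (y : Fin n → ℚ) :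
    ∃ σ : Equiv.Perm (Fin n), AdmissibleNumbering (fun i => X (σ i)) (fun i => y (σ i)) := by
  let φ : Fin n → ℚ := fun i => ∑ k, X i k ^ 2
  have hmono : Monotone (φ ∘ Tuple.sort φ) := Tuple.monotone_sort φ
  refine ⟨Tuple.sort φ, fun i j m hij hjm hX hseg => ?_⟩
  obtain ⟨a, b, ha, hb, hab, h⟩ := hseg
  have hx : ∀ k, a * X (Tuple.sort φ i) k + b * X (Tuple.sort φ j) k = X (Tuple.sort φ m) k :=
    fun k => by
      have := congrFun (congrArg Prod.fst h) k
      simpa using this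
  have him : φ (Tuple.sort φ i) ≤ φ (Tuple.sort φ m) := hmono (hij.trans hjm).le
  have hjm' : φ (Tuple.sort φ j) ≤ φ (Tuple.sort φ m) := hmono hjm.le
  have hφ : φ (Tuple.sort φ m) = a * φ (Tuple.sort φ i) + b * φ (Tuple.sort φ j) -
      a * b * ∑ k, (X (Tuple.sort φ i) k - X (Tuple.sort φ j) k) ^ 2 := by
    simp only [φ, Finset.mul_sum, ← Finset.sum_add_distrib, ← Finset.sum_sub_distrib, ← hx]
    refine Finset.sum_congr rfl fun k _ => ?_
    rw [← sub_eq_iff_eq_add'.2 hab.symm]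
    ring
  have hpos : 0 < ∑ k, (X (Tuple.sort φ i) k - X (Tuple.sort φ j) k) ^ 2 := by
    obtain ⟨k, hk⟩ := Function.ne_iff.1 hX
    exact Finset.sum_pos' (fun k _ => sq_nonneg _)
      ⟨k, Finset.mem_univ k, by have := sub_ne_zero.2 hk; positivity⟩
  have hab0 := mul_pos ha hb
  have := mul_pos hab0 hpos
  have h1 := mul_le_mul_of_nonneg_left him ha.le
  have h2 := mul_le_mul_of_nonneg_left hjm' hb.le
  have h3 : a * φ (Tuple.sort φ m) + b * φ (Tuple.sort φ m) = φ (Tuple.sort φ m) := by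
    rw [← add_mul, hab, one_mul]
  linarith

/-! ### Bit sizes -/

section Bits

variable {n p : ℕ} {X : Fin n → Fin p → ℚ} {y : Fin n → ℚ}

theorem two_le_bitsize (q : ℚ) : 2 ≤ bitsize q := by
  have : 0 < q.den.size := Nat.size_pos.2 q.den_pos
  unfold bitsize
  omega

theorem bitsize_zero : bitsize 0 = 2 := by simp [bitsize]

theorem bitsize_one : bitsize 1 = 3 := by simp [bitsize]

theorem bitsize_sub_le (a b : ℚ) : bitsize (a - b) ≤ 2 * (bitsize a + bitsize b) := by
  have hA := Nat.lt_size_self a.num.natAbs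
  have hB := Nat.lt_size_self a.den
  have hC := Nat.lt_size_self b.num.natAbs
  have hD := Nat.lt_size_self b.den
  have hden : (a - b).den ≤ a.den * b.den :=
    Nat.le_of_dvd (Nat.mul_pos a.den_pos b.den_pos) (Rat.sub_den_dvd a b)
  have hdsize : (a - b).den.size ≤ a.den.size + b.den.size := by
    rw [Nat.size_le, pow_add]
    exact hden.trans_lt (Nat.mul_lt_mul'' hB hD)
  have hnum : (a - b).num.natAbs ≤ a.num.natAbs * b.den + b.num.natAbs * a.den := by
    have h := congrArg Int.natAbs (Rat.substr_num_den' a b)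
    rw [Int.natAbs_mul, Int.natAbs_mul, Int.natAbs_mul, Int.natAbs_natCast, Int.natAbs_natCast,
      Int.natAbs_natCast, mul_assoc] at h
    have h1 : (a.num * b.den - b.num * a.den).natAbs ≤
        a.num.natAbs * b.den + b.num.natAbs * a.den := by
      refine (Int.natAbs_sub_le _ _).trans (le_of_eq ?_)
      rw [Int.natAbs_mul, Int.natAbs_mul, Int.natAbs_natCast, Int.natAbs_natCast]
    refine Nat.le_of_mul_le_mul_right ?_ (Nat.mul_pos a.den_pos b.den_pos)
    rw [h]
    exact Nat.mul_le_mul h1 hden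
  have hnsize : (a - b).num.natAbs.size ≤
      a.num.natAbs.size + a.den.size + b.num.natAbs.size + b.den.size + 1 := by
    rw [Nat.size_le]
    have h1 : a.num.natAbs * b.den < 2 ^ (a.num.natAbs.size + b.den.size) := by
      rw [pow_add]; exact Nat.mul_lt_mul'' hA hD
    have h2 : b.num.natAbs * a.den < 2 ^ (b.num.natAbs.size + a.den.size) := by
      rw [pow_add]; exact Nat.mul_lt_mul'' hC hB
    have h3 : 2 ^ (a.num.natAbs.size + b.den.size) ≤
        2 ^ (a.num.natAbs.size + a.den.size + b.num.natAbs.size + b.den.size) :=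
      Nat.pow_le_pow_right two_pos (by omega)
    have h4 : 2 ^ (b.num.natAbs.size + a.den.size) ≤
        2 ^ (a.num.natAbs.size + a.den.size + b.num.natAbs.size + b.den.size) :=
      Nat.pow_le_pow_right two_pos (by omega)
    rw [pow_succ]
    omega
  unfold bitsize
  omega

/-- The bit size of a row. -/
def rowBits (X : Fin n → Fin p → ℚ) (y : Fin n → ℚ) (i : Fin n) : ℕ :=
  ∑ k, bitsize (X i k) + bitsize (y i)

theorem two_mul_le_rowBits (i : Fin n) : 2 * (p + 1) ≤ rowBits X y i := by
  have h1 : ∑ _k : Fin p, 2 ≤ ∑ k, bitsize (X i k) :=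
    Finset.sum_le_sum fun k _ => two_le_bitsize _
  have h2 := two_le_bitsize (y i)
  simp only [Finset.sum_const, Finset.card_univ, Fintype.card_fin, smul_eq_mul] at h1
  unfold rowBits
  omega

theorem rowBits_le (i : Fin n) : rowBits X y i ≤ dataBitsize X y :=
  Finset.single_le_sum (f := rowBits X y) (fun _ _ => Nat.zero_le _) (Finset.mem_univ i)

theorem le_dataBitsize : n * (2 * (p + 1)) ≤ dataBitsize X y := by
  have h : ∑ _i : Fin n, 2 * (p + 1) ≤ ∑ i, rowBits X y i :=
    Finset.sum_le_sum fun i _ => two_mul_le_rowBits i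
  rw [show dataBitsize X y = ∑ i, rowBits X y i from rfl]
  simpa using h

/-- The bit size of a constraint. -/
def constraintBits {q : ℕ} (c : (Fin q → ℚ) × ℚ) : ℕ := ∑ k, bitsize (c.1 k) + bitsize c.2

theorem constraintBits_constraintRow {t : ℚ} (ht : bitsize t ≤ 3) (a b : Fin n) :
    constraintBits (constraintRow X y t a b).val ≤ 2 * (rowBits X y a + rowBits X y b) + 3 := by
  rw [constraintRow_val, constraintBits, Fin.sum_univ_castSucc]
  simp only [Fin.snoc_castSucc, Fin.snoc_last]
  have h1 : ∑ k, bitsize (X b k - X a k) ≤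
      2 * (∑ k, bitsize (X b k) + ∑ k, bitsize (X a k)) := by
    rw [← Finset.sum_add_distrib, Finset.mul_sum]
    exact Finset.sum_le_sum fun k _ => bitsize_sub_le _ _
  have h2 := bitsize_sub_le (y b) (y a)
  unfold rowBits
  omega

theorem sum_bitsize_lastUnit : ∑ k, bitsize (lastUnit p k) ≤ 3 * (p + 1) := by
  have h : ∑ k, bitsize (lastUnit p k) ≤ ∑ _k : Fin (p + 1), 3 := by
    refine Finset.sum_le_sum fun k _ => ?_
    unfold lastUnit
    split_ifs
    · exact bitsize_one.le
    · rw [bitsize_zero]; norm_num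
  simpa [mul_comm] using h

theorem sum_filterMap_le {α ι : Type} (g : ι → Option α) (w : α → ℕ) (w' : ι → ℕ)
    (h : ∀ i a, g i = some a → w a ≤ w' i) (l : List ι) :
    ((l.filterMap g).map w).sum ≤ (l.map w').sum := by
  induction l with
  | nil => simp
  | cons i l ih =>
    cases hg : g i with
    | none =>
      rw [List.filterMap_cons_none hg, List.map_cons, List.sum_cons]
      omega
    | some a =>
      have := h i a hg
      rw [List.filterMap_cons_some hg, List.map_cons, List.map_cons, List.sum_cons, List.sum_cons]
      omega

/-- The cyclic successor. -/
def cyclicSucc (m : Fin n) : Fin n := ⟨(m + 1) % n, Nat.mod_lt _ m.pos⟩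

theorem cyclicSucc_injective : Function.Injective (cyclicSucc (n := n)) := by
  intro a b h
  have h1 : a + 1 ≡ b + 1 [MOD n] := congrArg Fin.val h
  have h2 := Nat.ModEq.add_right_cancel' 1 h1
  rw [Nat.ModEq, Nat.mod_eq_of_lt a.2, Nat.mod_eq_of_lt b.2] at h2
  exact Fin.ext h2

theorem sum_rowBits_comp {f : Fin n → Fin n} (hf : Function.Injective f) :
    ∑ i, rowBits X y (f i) = dataBitsize X y :=
  Equiv.sum_comp (Equiv.ofBijective f ⟨hf, Finite.surjective_of_injective hf⟩) (rowBits X y)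

theorem tightnessLP_constraints_le (R : Finset (Fin n × Fin n)) (π : Fin n → Fin n)
    (k l : Fin n) : (tightnessLP X y R π k l).val.constraints ≤ n + 2 := by
  have h := List.length_filterMap_le (tightnessRow X y R π k l) (List.finRange n)
  rw [List.length_finRange] at h
  rw [tightnessLP_val, LP.constraints]
  simp only [List.length_cons, List.length_reverse, List.length_nil]
  omega

/-- Each row occurs in at most two of the constraints that come from adjacent positions. -/
theorem tightnessLP_bitsize_le (hp : 1 ≤ p) (R : Finset (Fin n × Fin n)) {π : Fin n → Fin n}
    (hπ : Function.Injective π) (k l : Fin n) :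
    (tightnessLP X y R π k l).val.bitsize ≤ 14 * dataBitsize X y := by
  have hrows : (((List.finRange n).filterMap (tightnessRow X y R π k l)).map constraintBits).sum ≤
      4 * dataBitsize X y + 3 * n := by
    refine (sum_filterMap_le _ constraintBits
      (fun m => 2 * (rowBits X y (π m) + rowBits X y (π (cyclicSucc m))) + 3) ?_ _).trans ?_
    · intro m c hm
      unfold tightnessRow at hm
      split_ifs at hm with h1 h2
      have : cyclicSucc m = ⟨m + 1, h1⟩ := Fin.ext (Nat.mod_eq_of_lt h1)
      rw [← Option.some.inj hm, this]
      exact constraintBits_constraintRow bitsize_one.le _ _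
    · rw [← List.ofFn_eq_map, List.sum_ofFn, Finset.sum_add_distrib, ← Finset.mul_sum,
        Finset.sum_add_distrib, sum_rowBits_comp hπ,
        sum_rowBits_comp (f := fun m => π (cyclicSucc m)) (hπ.comp cyclicSucc_injective)]
      simp only [Finset.sum_const, Finset.card_univ, Fintype.card_fin, smul_eq_mul]
      omega
  have hunit := sum_bitsize_lastUnit (p := p)
  have hone := bitsize_one
  have heqn := constraintBits_constraintRow (X := X) (y := y) (t := 0)
    (by rw [bitsize_zero]; norm_num) k l
  have hk := rowBits_le (X := X) (y := y) k
  have hl := rowBits_le (X := X) (y := y) l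
  have hk2 := two_mul_le_rowBits (X := X) (y := y) k
  have hD := le_dataBitsize (X := X) (y := y)
  have hn : n * 4 ≤ n * (2 * (p + 1)) := Nat.mul_le_mul_left n (by omega)
  have hbound : constraintBits (lastUnit p, (1 : ℚ)) ≤ 3 * (p + 1) + 3 := by
    exact add_le_add hunit hone.le
  rw [tightnessLP_val, LP.bitsize]
  change _ + (List.map constraintBits _).sum ≤ _
  simp only [List.cons_append, List.map_cons, List.sum_cons, List.map_append, List.sum_append,
    List.map_reverse, List.sum_reverse, List.map_nil, List.sum_nil]
  omega

/-- A solver that reads its input needs at least `n (p + 2)` steps for some linear program of the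
admitted size. -/
theorem le_lpTime {S : LPSolver} {f : ℕ → ℕ → ℕ → ℕ} (hf : BoundsLPCost S.time f) {m v B : ℕ}
    (hm : n ≤ m) (hv : p + 1 ≤ v) (hB : 3 * dataBitsize X y ≤ B) (hn : 1 ≤ n) :
    n * (p + 2) ≤ f m v B := by
  let I : LP (p + 1) := { obj := 0, ineqs := List.replicate n (0, 0), eqs := [] }
  have hc : I.constraints = n := by simp [I, LP.constraints]
  have hb : I.bitsize = (p + 1) * 2 + n * ((p + 1) * 2 + 2) := by
    simp [I, LP.bitsize, bitsize_zero, List.sum_replicate]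
  have hD := le_dataBitsize (X := X) (y := y)
  have h1 := S.reads I
  rw [hc] at h1
  refine h1.trans (hf m v B _ I (hc.le.trans hm) hv (le_trans ?_ hB))
  rw [hb]
  nlinarith

end Bits

/-! ### Time -/

section Time

variable {n p : ℕ} {X : Fin n → Fin p → ℚ} {y : Fin n → ℚ}

theorem residuals_time_le (β : Fin p → ℚ) : (residuals X y β).time ≤ n * (2 * p + 2) := by
  refine tabulate_time_le (c := 2 * p + 1) fun i => ?_
  have := sum_time_le (f := fun k => tick (X i k * β k)) (c := 1) fun k => le_rfl
  simp only [bind_time, tick_time]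
  omega

theorem clog_two_le_self (n : ℕ) : Nat.clog 2 n ≤ n :=
  Nat.clog_le_of_le_pow Nat.lt_two_pow_self.le

theorem sortResiduals_time_le (hn : 1 ≤ n) (β : Fin p → ℚ) :
    (sortResiduals X y β).time ≤ n * (2 * p + 5) + 3 * (n * n) := by
  have h1 := residuals_time_le (X := X) (y := y) β
  have h2 := mergeSort_time_le (le := fun i j => tick (decide ((residuals X y β).val i ≤
    (residuals X y β).val j))) (c := 1) (fun _ _ => le_rfl) (List.finRange n)
  rw [List.length_finRange, max_eq_left hn] at h2
  have h3 : (1 + 2) * n * Nat.clog 2 n ≤ (1 + 2) * n * n :=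
    Nat.mul_le_mul_left _ (clog_two_le_self n)
  have h4 := tabulate_time_le (n := n) (c := 1) (f := fun i => tick
    ((((mergeSort (fun i j => tick (decide ((residuals X y β).val i ≤ (residuals X y β).val j)))
      (List.finRange n)).val)[(i : ℕ)]?).getD i)) fun i => le_rfl
  simp only [sortResiduals, reserving_time, bind_time]
  nlinarith

theorem constraintRow_time_le (t : ℚ) (a b : Fin n) :
    (constraintRow X y t a b).time ≤ 2 * p + 4 := by
  have := tabulate_time_le (f := fun k => tick (X b k - X a k)) (c := 1) fun k => le_rfl
  simp only [constraintRow, bind_time, steps_time]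
  omega

theorem tightnessLP_time_le (R : Finset (Fin n × Fin n)) (π : Fin n → Fin n) (k l : Fin n) :
    (tightnessLP X y R π k l).time ≤ n * (2 * p + 10) + 4 * p + 7 := by
  have h1 := tabulate_time_le (f := fun m : Fin (p + 1) =>
    tick (if m = Fin.last p then (1 : ℚ) else 0)) (c := 1) fun k => le_rfl
  have h2 := constraintRow_time_le (X := X) (y := y) 0 k l
  simp only [tightnessLP, bind_time, tick_time]
  refine le_trans (add_le_add h1 (add_le_add (loop_time_le (c := 2 * p + 9) ?_ _ _)
    (add_le_add h2 le_rfl))) ?_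
  · intro s m
    by_cases h : (m : ℕ) + 1 < n
    · have := constraintRow_time_le (X := X) (y := y) 1 (π m) (π ⟨m + 1, h⟩)
      rw [dif_pos h]
      split_ifs <;> simp only [bind_time, steps_time] <;> omega
    · rw [dif_neg h]; simp
  · rw [List.length_finRange]
    nlinarith

theorem tightnessTest_time_le (S : LPSolver) (R : Finset (Fin n × Fin n)) (π : Fin n → Fin n)
    (k l : Fin n) :
    (tightnessTest S X y R π k l).time ≤
      n * (2 * p + 10) + 5 * p + 8 + S.time (tightnessLP X y R π k l).val := by
  have h1 := tightnessLP_time_le (X := X) (y := y) R π k l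
  simp only [tightnessTest, reserving_time, bind_time, LPSolver.call]
  split
  · split_ifs
    · simp only [steps_time]; omega
    · simp only [tick_time]; omega
  · simp only [tick_time]; omega

theorem length_allPairs : (allPairs n).length = n * n := by
  simp only [allPairs]
  rw [List.length_product, List.length_finRange]

theorem nextPoint_time_le (β w : Fin p → ℚ) :
    (nextPoint X y β w).time ≤ n * (4 * p + 4) + 9 * (n * n) + 7 * p := by
  have h1 := residuals_time_le (X := X) (y := y) β
  have h2 := residuals_time_le (X := X) (y := y) w
  simp only [nextPoint, reserving_time, bind_time]
  refine le_trans (add_le_add h1 (add_le_add h2 (add_le_add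
    (loop_time_le (c := 8) ?_ _ _) (?_ : _ ≤ 7 * p)))) ?_
  · intro s e
    simp
  · split
    · exact (tabulate_time_le (c := 6) fun k => le_rfl).trans (by omega)
    · exact (tabulate_time_le (c := 2) fun k => le_rfl).trans (by omega)
  · rw [length_allPairs]
    nlinarith

theorem visit_time (β : Fin p → ℚ) (rest : (Fin n → Fin n) → Cost (List (Fin n → Fin n))) :
    (visit X y β rest).time =
      (sortResiduals X y β).time + (n + (rest (sortResiduals X y β).val).time) := rfl

/-- The cost of a round apart from the recursive call and from what is done only for a new cell;
`T` bounds the time of the linear programs. -/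
def roundTime (n p T : ℕ) : ℕ := n * (2 * p + 10) + 5 * p + 18 + T

/-- What is charged to each output cell: a complete loop in its own call, and the steps before and
after that call. -/
def cellTime (n p T : ℕ) : ℕ :=
  n * roundTime n p T + (n * (8 * p + 15) + 15 * (n * n) + 7 * p + 5)

/-- Each round is charged to the call that it belongs to, and each call to the cell that it outputs
first. -/
theorem rounds_time_le (S : LPSolver) (hn : 1 ≤ n) (R : Finset (Fin n × Fin n)) {T : ℕ}
    (hT : ∀ π : Fin n → Fin n, Function.Injective π → ∀ k l,
      S.time (tightnessLP X y R π k l).val ≤ T)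
    (β : Fin p → ℚ) (L : Finset (Fin n × Fin n)) (π : Fin n → Fin n) (i : ℕ)
    (hπ : Function.Injective π) :
    (rounds S X y R β L π i).time ≤
      (n - i) * roundTime n p T + cellTime n p T * (rounds S X y R β L π i).val.length + 1 := by
  induction β, L, π, i using rounds_induction with
  | step β L π i ih₁ ih₂ =>
  by_cases hin : i + 1 < n
  swap
  · rw [rounds_of_not_lt hin]
    simp
  have hsub : (n - i) * roundTime n p T = (n - (i + 1)) * roundTime n p T + roundTime n p T := by
    rw [← Nat.succ_mul]; congr 1; omega
  generalize he_def : orderedPair (π ⟨i, by omega⟩) (π ⟨i + 1, hin⟩) = e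
  by_cases he : e ∈ R ∪ L
  · rw [rounds_of_mem hin (by rw [he_def]; exact he)]
    have := ih₂ hin hπ
    simp only [bind_val, bind_time, steps_time]
    have hr : 10 ≤ roundTime n p T := by unfold roundTime; omega
    omega
  have heL : e ∉ L := fun h => he (Finset.mem_union_right _ h)
  rw [rounds_of_not_mem hin he_def he]
  have htest := tightnessTest_time_le (X := X) (y := y) S R π e.1 e.2
  have hTπ := hT π hπ e.1 e.2
  have hr : 10 + (tightnessTest S X y R π e.1 e.2).time ≤ roundTime n p T := by
    unfold roundTime; omega
  simp only [bind_val, bind_time, steps_time]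
  cases hfound : (tightnessTest S X y R π e.1 e.2).val with
  | none =>
    have := ih₂ hin hπ
    simp only
    omega
  | some w =>
    simp only [bind_val, bind_time, reserving_val, reserving_time, steps_time, visit_val,
      visit_time, pure_val, pure_time, List.length_append, List.length_cons]
    set β₀ := (nextPoint X y β w).val
    have h₁ := ih₁ e heL β₀ (sortResiduals X y β₀).val 0 (sortResiduals_injective β₀)
    have h₂ := ih₁ e heL β (sortResiduals X y β).val (i + 1) (sortResiduals_injective β)
    have hs := sortResiduals_time_le (X := X) (y := y) hn β
    have hs₀ := sortResiduals_time_le (X := X) (y := y) hn β₀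
    have hnp := nextPoint_time_le (X := X) (y := y) β w
    rw [Nat.sub_zero] at h₁
    have hcell : cellTime n p T =
      n * roundTime n p T + (n * (8 * p + 15) + 15 * (n * n) + 7 * p + 5) := rfl
    have hexp : n * (8 * p + 15) = 2 * (n * (2 * p + 5)) + n * (4 * p + 4) + n := by ring
    rw [add_right_comm, mul_add, mul_add, mul_one]
    omega

theorem visit_time_le (S : LPSolver) (hn : 1 ≤ n) (R : Finset (Fin n × Fin n)) {T : ℕ}
    (hT : ∀ π : Fin n → Fin n, Function.Injective π → ∀ k l,
      S.time (tightnessLP X y R π k l).val ≤ T)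
    (β : Fin p → ℚ) (L : Finset (Fin n × Fin n)) :
    (visit X y β fun π => rounds S X y R β L π 0).time ≤
      cellTime n p T * (visit X y β fun π => rounds S X y R β L π 0).val.length := by
  have h := rounds_time_le S hn R hT β L _ 0 (sortResiduals_injective (X := X) (y := y) β)
  have hs := sortResiduals_time_le (X := X) (y := y) hn β
  rw [visit_time, visit_val, List.length_cons, mul_add, mul_one]
  rw [Nat.sub_zero] at h
  have hcell : cellTime n p T =
    n * roundTime n p T + (n * (8 * p + 15) + 15 * (n * n) + 7 * p + 5) := rfl
  have hexp : n * (8 * p + 15) = 2 * (n * (2 * p + 5)) + n * (4 * p + 4) + n := by ring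
  omega

theorem normalForm_time_le (i j : Fin n) : (normalForm X y i j).time ≤ 6 * p + 6 := by
  simp only [normalForm, bind_time]
  refine le_trans (add_le_add (tabulate_time_le (c := 1) fun k => le_rfl)
    (add_le_add (loop_time_le (c := 1) (fun s k => le_rfl) _ _)
      (tabulate_time_le (c := 1) fun k => le_rfl))) ?_
  rw [List.length_finRange]
  omega

theorem compareVectors_time_le {d : ℕ} (u v : Fin d → ℚ) :
    (compareVectors u v).time ≤ 2 * d := by
  refine (loop_time_le (c := 1) (fun o k => le_rfl) _ _).trans ?_
  rw [List.length_finRange]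
  omega

theorem markRepeated_time_le {d : ℕ} (l : List ((Fin d → ℚ) × (Fin n × Fin n))) :
    (markRepeated l).time ≤ l.length * (2 * d + 1) := by
  fun_induction markRepeated l with
  | case1 u v l ih =>
    have h := compareVectors_time_le u.1 v.1
    simp only [bind_time, tick_time]
    rw [List.length_cons, Nat.succ_mul]
    omega
  | case2 l h => simp

theorem length_hyperplaneTable_le : (hyperplaneTable X y).length ≤ n * n := by
  rw [hyperplaneTable, List.length_reverse, ← length_allPairs]
  exact List.length_filterMap_le _ _

theorem constructR_time_le (hn : 1 ≤ n) :
    (constructR X y).time ≤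
      (4 * p + 14) * (n * n) * Nat.clog 2 n + (8 * p + 14) * (n * n) := by
  have h1 : (tableLoop X y).time ≤ n * n * (6 * p + 10) := by
    refine (loop_time_le (c := 6 * p + 9) (fun s e => ?_) _ _).trans (by rw [length_allPairs])
    split_ifs
    · have := normalForm_time_le (X := X) (y := y) e.1 e.2
      simp only [bind_time, steps_time]
      omega
    · simp
  have h2 := mergeSort_time_le (le := compareEntries (n := n) (d := p + 1)) (c := 2 * p + 5)
    (fun u v => by
      have := compareVectors_time_le u.1 v.1
      simp only [compareEntries, bind_time, steps_time]
      omega) (hyperplaneTable X y)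
  have h3 := markRepeated_time_le (mergeSort compareEntries (hyperplaneTable X y)).val
  rw [(mergeSort_perm _ _).length_eq] at h3
  have hlen := length_hyperplaneTable_le (X := X) (y := y)
  have hlog : Nat.clog 2 (hyperplaneTable X y).length ≤ 2 * Nat.clog 2 n := by
    refine Nat.clog_le_of_le_pow (hlen.trans ?_)
    have := Nat.le_pow_clog one_lt_two n
    rw [two_mul, pow_add]
    exact Nat.mul_le_mul this this
  have h2' : (2 * p + 5 + 2) * (hyperplaneTable X y).length *
      Nat.clog 2 (hyperplaneTable X y).length ≤
      (2 * p + 5 + 2) * (n * n) * (2 * Nat.clog 2 n) := by gcongr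
  have h3' : (hyperplaneTable X y).length * (2 * (p + 1) + 1) ≤
      n * n * (2 * (p + 1) + 1) := Nat.mul_le_mul_right _ hlen
  have hmax : max (hyperplaneTable X y).length 1 ≤ n * n :=
    max_le hlen (Nat.mul_pos hn hn)
  rw [constructR_eq]
  simp only [reserving_time, bind_time, tableLoop_val]
  nlinarith

/-- For `n = 1` both sides vanish; for `n ≥ 2` the rounding up is at most `1 ≤ log n / log 2`. -/
theorem clog_two_le_log (hn : 1 ≤ n) : (Nat.clog 2 n : ℝ) ≤ 3 * Real.log n := by
  rcases hn.eq_or_lt with rfl | hn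
  · simp
  have h1 : 2 ^ (Nat.clog 2 n - 1) < n := Nat.pow_pred_clog_lt_self one_lt_two hn
  have hc : 1 ≤ Nat.clog 2 n := Nat.clog_pos one_lt_two hn
  have h2 : ((Nat.clog 2 n - 1 : ℕ) : ℝ) * Real.log 2 ≤ Real.log n := by
    rw [← Real.log_pow]
    exact Real.log_le_log (by positivity) (by exact_mod_cast h1.le)
  have h3 : Real.log 2 ≤ Real.log n := Real.log_le_log two_pos (by exact_mod_cast hn)
  rw [Nat.cast_sub hc, Nat.cast_one] at h2
  have h4 := Real.log_two_gt_d9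
  have h5 : (1 : ℝ) ≤ Nat.clog 2 n := by exact_mod_cast hc
  nlinarith

end Time

/-! ### Space -/

section Space

variable {n p : ℕ} {X : Fin n → Fin p → ℚ} {y : Fin n → ℚ}

theorem residuals_space (β : Fin p → ℚ) : (residuals X y β).space = 0 := by
  refine Nat.le_zero.1 (tabulate_space_le fun i => ?_)
  have := sum_space_le (f := fun k => tick (X i k * β k)) (c := 0) fun k => le_rfl
  simp only [bind_space, tick_space]
  omega

theorem sortResiduals_space_le (β : Fin p → ℚ) : (sortResiduals X y β).space ≤ 5 * n := by
  have h1 := residuals_space (X := X) (y := y) β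
  have h2 := mergeSort_space_le (le := fun i j => tick (decide ((residuals X y β).val i ≤
    (residuals X y β).val j))) (c := 0) (fun _ _ => le_rfl) (List.finRange n)
  rw [List.length_finRange] at h2
  have h4 := tabulate_space_le (n := n) (c := 0) (f := fun i => tick
    ((((mergeSort (fun i j => tick (decide ((residuals X y β).val i ≤ (residuals X y β).val j)))
      (List.finRange n)).val)[(i : ℕ)]?).getD i)) fun i => le_rfl
  simp only [sortResiduals, reserving_space, bind_space]
  omega

theorem constraintRow_space (t : ℚ) (a b : Fin n) : (constraintRow X y t a b).space = 0 := by
  have := tabulate_space_le (f := fun k => tick (X b k - X a k)) (c := 0) fun k => le_rfl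
  simp only [constraintRow, bind_space, steps_space]
  omega

theorem tightnessLP_space (R : Finset (Fin n × Fin n)) (π : Fin n → Fin n) (k l : Fin n) :
    (tightnessLP X y R π k l).space = 0 := by
  refine Nat.le_zero.1 ?_
  simp only [tightnessLP, bind_space, tick_space]
  refine max_le (tabulate_space_le fun k => le_rfl)
    (max_le (loop_space_le ?_ _ _) (max_le (constraintRow_space _ _ _).le le_rfl))
  intro s m
  split_ifs <;> simp [constraintRow_space]

theorem tightnessTest_space_le (S : LPSolver) (R : Finset (Fin n × Fin n)) (π : Fin n → Fin n)
    (k l : Fin n) :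
    (tightnessTest S X y R π k l).space ≤
      S.space (tightnessLP X y R π k l).val + (n + 2) * (p + 2) := by
  simp only [tightnessTest, reserving_space, bind_space, LPSolver.call, tightnessLP_space]
  refine Nat.add_le_add_right (max_le (Nat.zero_le _) (max_le le_rfl ?_)) _
  split
  · split_ifs <;> simp
  · simp

theorem nextPoint_space_le (β w : Fin p → ℚ) : (nextPoint X y β w).space ≤ 2 * n + p + 1 := by
  simp only [nextPoint, reserving_space, bind_space, residuals_space]
  have h : ∀ m : ℕ, m ≤ 0 → m + (2 * n + p + 1) ≤ 2 * n + p + 1 := fun m hm => by omega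
  refine h _ (max_le le_rfl (max_le le_rfl (max_le (loop_space_le ?_ _ _) ?_)))
  · intro s e
    simp
  · split
    · exact tabulate_space_le fun k => le_rfl
    · exact tabulate_space_le fun k => le_rfl

theorem visit_space (β : Fin p → ℚ) (rest : (Fin n → Fin n) → Cost (List (Fin n → Fin n))) :
    (visit X y β rest).space =
      max (sortResiduals X y β).space (max 0 (max (rest (sortResiduals X y β).val).space 0)) +
        (p + 3) := rfl

/-- A nested call has a longer list, and the pairs in the list are distinct; thus the depth of the
recursion is at most `n²`, and each level needs `p + 5` words. -/
theorem rounds_space_le (S : LPSolver) (R : Finset (Fin n × Fin n)) {M : ℕ}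
    (hM : ∀ π : Fin n → Fin n, Function.Injective π → ∀ k l,
      (tightnessTest S X y R π k l).space ≤ M)
    (hsort : 5 * n ≤ M) (hnext : 2 * n + p + 1 + p ≤ M)
    (β : Fin p → ℚ) (L : Finset (Fin n × Fin n)) (π : Fin n → Fin n) (i : ℕ)
    (hπ : Function.Injective π) :
    (rounds S X y R β L π i).space ≤ (p + 5) * (Finset.univ \ L).card + M := by
  induction β, L, π, i using rounds_induction with
  | step β L π i ih₁ ih₂ =>
  by_cases hin : i + 1 < n
  swap
  · rw [rounds_of_not_lt hin]
    simp
  generalize he_def : orderedPair (π ⟨i, by omega⟩) (π ⟨i + 1, hin⟩) = e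
  by_cases he : e ∈ R ∪ L
  · rw [rounds_of_mem hin (by rw [he_def]; exact he)]
    have := ih₂ hin hπ
    simp only [bind_space, steps_space]
    omega
  have heL : e ∉ L := fun h => he (Finset.mem_union_right _ h)
  rw [rounds_of_not_mem hin he_def he]
  have htest := hM π hπ e.1 e.2
  simp only [bind_space, steps_space]
  cases hfound : (tightnessTest S X y R π e.1 e.2).val with
  | none =>
    have := ih₂ hin hπ
    simp only
    omega
  | some w =>
    simp only [bind_space, reserving_val, reserving_space, steps_space,
      visit_space, pure_space]
    set β₀ := (nextPoint X y β w).val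
    have h₁ := ih₁ e heL β₀ (sortResiduals X y β₀).val 0 (sortResiduals_injective β₀)
    have h₂ := ih₁ e heL β (sortResiduals X y β).val (i + 1) (sortResiduals_injective β)
    have hs := sortResiduals_space_le (X := X) (y := y) β
    have hs₀ := sortResiduals_space_le (X := X) (y := y) β₀
    have hnp := nextPoint_space_le (X := X) (y := y) β w
    have hcard : (Finset.univ \ L).card = (Finset.univ \ insert e L).card + 1 := by
      rw [Finset.sdiff_insert, Finset.card_erase_add_one]
      exact Finset.mem_sdiff.2 ⟨Finset.mem_univ e, heL⟩
    rw [hcard, mul_add, mul_one]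
    omega

theorem constructR_space_le : (constructR X y).space ≤ n * n * (p + 7) := by
  have h1 : (tableLoop X y).space ≤ 0 := by
    refine loop_space_le (fun s e => ?_) _ _
    split_ifs
    · simp only [normalForm, bind_space, steps_space]
      exact max_le (max_le (tabulate_space_le fun k => le_rfl)
        (max_le (loop_space_le (fun s k => (tick_space _).le) _ _)
          (tabulate_space_le fun k => le_rfl))) le_rfl
    · simp
  have hcmp : ∀ u v : Fin (p + 1) → ℚ, (compareVectors u v).space ≤ 0 := fun u v =>
    loop_space_le (fun s k => (tick_space _).le) _ _
  have h2 := mergeSort_space_le (le := compareEntries (n := n) (d := p + 1)) (c := 0)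
    (fun u v => by
      have := hcmp u.1 v.1
      simp only [compareEntries, bind_space, steps_space]
      omega) (hyperplaneTable X y)
  have h3 : ∀ l : List ((Fin (p + 1) → ℚ) × (Fin n × Fin n)), (markRepeated l).space ≤ 0 := by
    intro l
    fun_induction markRepeated l with
    | case1 u v l ih =>
      have h := hcmp u.1 v.1
      simp only [bind_space, tick_space]
      omega
    | case2 l h => simp
  have h3' := h3 (mergeSort compareEntries (hyperplaneTable X y)).val
  have hlen := length_hyperplaneTable_le (X := X) (y := y)
  rw [constructR_eq]
  simp only [reserving_space, bind_space, tableLoop_val]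
  have : n * n * (p + 7) = n * n * (p + 4) + 3 * (n * n) := by ring
  omega

end Space

/-! ### The bounds for the whole algorithm -/

section Total

variable {n p : ℕ} {X : Fin n → Fin p → ℚ} {y : Fin n → ℚ}

/-- As `T ≥ n (p + 2)`, the linear programs of a call dominate all its other work. -/
theorem cellTime_le (hn : 1 ≤ n) (hp : 1 ≤ p) {T : ℕ} (hT : n * (p + 2) ≤ T) :
    cellTime n p T ≤ 86 * (n * T) := by
  have h1 : n * n ≤ n * n * p := Nat.le_mul_of_pos_right _ hp
  have h2 : n * p ≤ n * n * p := Nat.mul_le_mul_right p (Nat.le_mul_of_pos_right n hn)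
  have h3 : n ≤ n * p := Nat.le_mul_of_pos_right n hp
  have h4 : p ≤ n * p := Nat.le_mul_of_pos_left p hn
  have h5 : n * (n * (p + 2)) ≤ n * T := Nat.mul_le_mul_left n hT
  have h6 : n * (n * (p + 2)) = n * n * p + 2 * (n * n) := by ring
  have h7 : cellTime n p T = n * T + 2 * (n * n * p) + 25 * (n * n) + 13 * (n * p) + 33 * n +
      7 * p + 5 := by
    unfold cellTime roundTime; ring
  omega

theorem rsIncEnu_time_le (S : LPSolver) (hn : 1 ≤ n) (hp : 1 ≤ p) {T : ℕ}
    (hT : ∀ π : Fin n → Fin n, Function.Injective π → ∀ (R : Finset (Fin n × Fin n)) (k l),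
      S.time (tightnessLP X y R π k l).val ≤ T)
    (hT' : n * (p + 2) ≤ T) (β : Fin p → ℚ) :
    (rsIncEnu S X y β).time ≤ 110 * (n * (rsIncEnu S X y β).val.length * T) +
      18 * (n * n * p * Nat.clog 2 n) := by
  have htime : (rsIncEnu S X y β).time = (constructR X y).time + (2 * (n * n) +
    (visit X y β fun π => rounds S X y (constructR X y).val β ∅ π 0).time) := rfl
  have hval : (rsIncEnu S X y β).val =
    (visit X y β fun π => rounds S X y (constructR X y).val β ∅ π 0).val := rfl
  have hlen : 1 ≤ (rsIncEnu S X y β).val.length := by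
    rw [hval, visit_val, List.length_cons]; omega
  have hv := visit_time_le S hn (constructR X y).val (fun π hπ => hT π hπ _) β ∅
  rw [← hval] at hv
  have hc := constructR_time_le (X := X) (y := y) hn
  have hcell := Nat.mul_le_mul_right (rsIncEnu S X y β).val.length (cellTime_le hn hp hT')
  generalize (rsIncEnu S X y β).val.length = N at *
  have h1 : n * n ≤ n * n * p := Nat.le_mul_of_pos_right _ hp
  have h2 : n * n * p ≤ n * N * T := by
    calc n * n * p ≤ n * (n * (p + 2)) := by nlinarith
      _ ≤ n * T := Nat.mul_le_mul_left n hT'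
      _ ≤ n * N * T := Nat.mul_le_mul_right T (Nat.le_mul_of_pos_right n hlen)
  have h3 : n * n * Nat.clog 2 n ≤ n * n * p * Nat.clog 2 n := Nat.mul_le_mul_right _ h1
  have h4 : (4 * p + 14) * (n * n) * Nat.clog 2 n =
    4 * (n * n * p * Nat.clog 2 n) + 14 * (n * n * Nat.clog 2 n) := by ring
  have h5 : (8 * p + 14) * (n * n) = 8 * (n * n * p) + 14 * (n * n) := by ring
  have h6 : 86 * (n * T) * N = 86 * (n * N * T) := by ring
  omega

theorem rsIncEnu_space_le (S : LPSolver) (hn : 1 ≤ n) (hp : 1 ≤ p) {T : ℕ}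
    (hT : ∀ π : Fin n → Fin n, Function.Injective π → ∀ (R : Finset (Fin n × Fin n)) (k l),
      S.space (tightnessLP X y R π k l).val ≤ T) (β : Fin p → ℚ) :
    (rsIncEnu S X y β).space ≤ 80 * (T + n ^ 2 * p) := by
  have hspace : (rsIncEnu S X y β).space = max (constructR X y).space (max 0
    (visit X y β fun π => rounds S X y (constructR X y).val β ∅ π 0).space) +
      (n * (p + 1) + 2 * (n * n) + n + 20) := rfl
  have hr := rounds_space_le (X := X) (y := y) S (constructR X y).val
    (M := T + (n + 2) * (p + 2) + 5 * n + 2 * p + 1)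
    (fun π hπ k l => by
      have h1 := tightnessTest_space_le (X := X) (y := y) S (constructR X y).val π k l
      have h2 := hT π hπ (constructR X y).val k l
      omega) (by omega) (by omega) β ∅ _ 0 (sortResiduals_injective (X := X) (y := y) β)
  have hs := sortResiduals_space_le (X := X) (y := y) β
  have hc := constructR_space_le (X := X) (y := y)
  rw [Finset.sdiff_empty, Finset.card_univ, Fintype.card_prod, Fintype.card_fin] at hr
  rw [visit_space] at hspace
  have h1 : n * n ≤ n * n * p := Nat.le_mul_of_pos_right _ hp
  have h2 : n * p ≤ n * n * p := Nat.mul_le_mul_right p (Nat.le_mul_of_pos_right n hn)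
  have h3 : n ≤ n * p := Nat.le_mul_of_pos_right n hp
  have h4 : p ≤ n * p := Nat.le_mul_of_pos_left p hn
  have e1 : (p + 5) * (n * n) = n * n * p + 5 * (n * n) := by ring
  have e2 : (n + 2) * (p + 2) = n * p + 2 * n + 2 * p + 4 := by ring
  have e3 : n * n * (p + 7) = n * n * p + 7 * (n * n) := by ring
  have e4 : n * (p + 1) = n * p + n := by ring
  rw [sq]
  omega

end Total

end RankCells

open RankCells in
theorem mainTheorem4 :
    -- the rows can always be numbered in an admissible way
    (∀ (n p : ℕ) (X : Fin n → Fin p → ℚ) (y : Fin n → ℚ), ∃ σ : Equiv.Perm (Fin n),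
      AdmissibleNumbering (fun i => X (σ i)) (fun i => y (σ i))) ∧
    ∃ K : ℕ, ∀ (n p : ℕ), 1 ≤ n → 1 ≤ p →
      ∀ (X : Fin n → Fin p → ℚ) (y : Fin n → ℚ), DistinctRows X y → AdmissibleNumbering X y →
      ∀ β : Fin p → ℚ,
      (∃ π : Equiv.Perm (Fin n), (fun k => (β k : ℝ)) ∈ interior (region X y π)) →
      ∀ S : LPSolver,
        -- the list of redundant pairs is constructed correctly
        ((constructR X y).val : Set (Fin n × Fin n)) = redundantPairs X y ∧
        -- (a) exactly the cells are output, and each of them once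
        ((rsIncEnu S X y β).val.Nodup ∧
          ∀ f : Fin n → Fin n, f ∈ (rsIncEnu S X y β).val ↔ ∃ π ∈ cells X y, f = ⇑π) ∧
        -- (b) time and space
        (∀ lpTime : ℕ → ℕ → ℕ → ℕ, BoundsLPCost S.time lpTime →
          ((rsIncEnu S X y β).time : ℝ) ≤
            K * (n * (cells X y).ncard * lpTime (K * n) (K * p) (K * dataBitsize X y) +
              n ^ 2 * Real.log n * p)) ∧
        (∀ lpSpace : ℕ → ℕ → ℕ → ℕ, BoundsLPCost S.space lpSpace →
          (rsIncEnu S X y β).space ≤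
            K * (lpSpace (K * n) (K * p) (K * dataBitsize X y) + n ^ 2 * p)) := by
  refine ⟨fun n p X y => exists_admissibleNumbering X y, 110, ?_⟩
  rintro n p hn hp X y hd ha β ⟨π, hπ⟩ S
  have hβ := ((sortedAt_iff_mem_interior hd).2 hπ).residual_injective
  obtain ⟨hnodup, hmem⟩ := rsIncEnu_spec S hd ha hβ
  have hmem' : ∀ f : Fin n → Fin n,
      f ∈ (rsIncEnu S X y β).val ↔ ∃ π ∈ cells X y, f = ⇑π := fun f => by
    rw [hmem, exists_mem_cells_iff hd]
  -- the tightness tests are linear programs of the size that the cost bounds admit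
  have hlp : ∀ (cost : ∀ {q : ℕ}, LP q → ℕ) (f : ℕ → ℕ → ℕ → ℕ), BoundsLPCost cost f →
      ∀ π : Fin n → Fin n, Function.Injective π → ∀ (R : Finset (Fin n × Fin n)) (k l),
        cost (tightnessLP X y R π k l).val ≤ f (110 * n) (110 * p) (110 * dataBitsize X y) := by
    intro cost f hf π hπ R k l
    have h1 := tightnessLP_constraints_le (X := X) (y := y) R π k l
    have h2 := tightnessLP_bitsize_le (y := y) (X := X) hp R hπ k l
    exact hf _ _ _ _ _ (by omega) (by omega) (by omega)
  refine ⟨constructR_val hd, ⟨hnodup, hmem'⟩, fun lpTime hf => ?_, fun lpSpace hf => ?_⟩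
  · have h := rsIncEnu_time_le S hn hp (hlp S.time lpTime hf)
      (le_lpTime (X := X) (y := y) hf (by omega) (by omega) (by omega) hn) β
    rw [length_eq_ncard_cells hnodup hmem'] at h
    have h' : ((rsIncEnu S X y β).time : ℝ) ≤ 110 * (n * (cells X y).ncard *
        lpTime (110 * n) (110 * p) (110 * dataBitsize X y)) +
        18 * (n * n * p * Nat.clog 2 n) := by exact_mod_cast h
    have hlog := mul_le_mul_of_nonneg_left (clog_two_le_log hn)
      (by positivity : (0 : ℝ) ≤ n * n * p)
    have hpos : (0 : ℝ) ≤ n * n * p * Real.log n :=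
      mul_nonneg (by positivity) (Real.log_natCast_nonneg n)
    have hring : (n : ℝ) ^ 2 * Real.log n * p = n * n * p * Real.log n := by ring
    push_cast
    rw [mul_add, hring]
    linarith
  · exact (rsIncEnu_space_le S hn hp (hlp S.space lpSpace hf) β).trans
      (Nat.mul_le_mul_right _ (by norm_num))
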